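/- Fix $\tau\in(2,3)$, $C>0$ and $\lambda>0$, and put $\alpha=1/(\tau-1)$, $\eta_s=(3-\tau)/2$. Let $F$ be the distribution function with $1-F(x)=Cx^{-(\tau-1)}$ for $x\ge C^{\alpha}$ and $F(x)=0$ for $x<C^{\alpha}$, let $\mu=\int x\,F(\mathrm dx)$ be its mean, and for $n\ge1$ give vertex $i\in[n]=\{1,\dots,n\}$ the weight $w_i=[1-F]^{-1}(i/n)$, so that $w_i=c_F(n/i)^{\alpha}$ with $c_F=C^{\alpha}$. Let $\ell_n=\sum_{i\in[n]}w_i$. The random graph $\mathrm{NR}_n(\mathbf w)$ on $[n]$ has each edge $\{u,v\}$, $u\ne v$, independently with probability $p_{uv}=1-e^{-w_uw_v/\ell_n}$, and $\mathrm{NR}_n(\mathbf w,\pi_c(\lambda))$ is obtained from it by keeping each edge independently with probability $\pi_c(\lambda)=\lambda n^{-\eta_s}$ ($n$ large enough that $\pi_c(\lambda)\le 1$). For distinct $i,j\in[n]$ let $X_{ij}=X_{ij}^{(n)}$ be the number of paths of length two from $i$ to $j$ in $\mathrm{NR}_n(\mathbf w,\pi_c(\lambda))$, and for distinct $i,j\ge1$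 let $$\lambda_{ij}=\lambda^2\int_0^\infty\Theta_i(x)\Theta_j(x)\,\mathrm dx,\qquad \Theta_i(x)=1-e^{-c_F\theta_i x^{-\alpha}},\qquad \theta_i=\frac{c_F\, i^{-\alpha}}{\mu}.$$ Then, for all fixed distinct $i,j\ge1$, $$\lim_{n\to\infty}d_{\mathrm{TV}}\big(X_{ij},P_{ij}\big)=0,\qquad P_{ij}\sim\mathrm{Poisson}(\lambda_{ij}),$$ where $d_{\mathrm{TV}}$ is the total variation distance between laws. Moreover, for every fixed $K\ge1$ the family $(X_{ij})_{1\le i<j\le K}$ is asymptotically independent: as $n\to\infty$, the total variation distance between its joint law and the product of the laws of the $X_{ij}$ tends to $0$, and so does the total variation distance between its joint law and $\bigotimes_{1\le i<j\le K}\mathrm{Poisson}(\lambda_{ij})$. -/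

import Mathlib

open MeasureTheory ProbabilityTheory Filter Topology

namespace ScaleFreeNR

/-! ### Exponents, weights, and constants -/

/-- `α = 1 / (τ - 1)`. -/
noncomputable def alpha (τ : ℝ) : ℝ := 1 / (τ - 1)

/-- `η_s = (3 - τ) / 2`. -/
noncomputable def etaS (τ : ℝ) : ℝ := (3 - τ) / 2

/-- The constant `c_F = C ^ α`, characterized by `w_i = c_F * (n / i) ^ α`, see `weight_eq`. -/
noncomputable def cF (τ C : ℝ) : ℝ := C ^ alpha τ

/-- The law on `ℝ` whose distribution function `F` satisfies `1 - F x = C * x ^ (-(τ - 1))`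
wherever the right-hand side is at most one, see `one_sub_cdf_weightLaw`: the Pareto law with
scale `C ^ (1 / (τ - 1))` and shape `τ - 1`. -/
noncomputable def weightLaw (τ C : ℝ) : Measure ℝ := paretoMeasure (cF τ C) (τ - 1)

/-- `μ = E[W]`, where `W` has distribution function `F`. -/
noncomputable def meanWeight (τ C : ℝ) : ℝ := ∫ x, x ∂(weightLaw τ C)

/-- The weight `w_i = [1 - F]⁻¹ (i / n)` of the vertex `i ∈ {1, …, n}`. The function `1 - F` is
nonincreasing, and its inverse at `u ∈ (0, 1]` is the largest `x` with `u ≤ 1 - F x`. -/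
noncomputable def weight (τ C : ℝ) (n i : ℕ) : ℝ :=
  sSup {x : ℝ | (i : ℝ) / n ≤ 1 - cdf (weightLaw τ C) x}

/-- The total weight `ℓ_n`. -/
noncomputable def totalWeight (τ C : ℝ) (n : ℕ) : ℝ :=
  ∑ i ∈ Finset.Icc 1 n, weight τ C n i

/-! ### The percolated Norros-Reittu graph -/

/-- The edge probability `p_{uv} = 1 - exp (-w_u w_v / ℓ_n)` of `NR_n(w)`. -/
noncomputable def edgeProb (τ C : ℝ) (n : ℕ) : Sym2 ℕ → ℝ :=
  Sym2.lift ⟨fun u v => 1 - Real.exp (-(weight τ C n u * weight τ C n v / totalWeight τ C n)),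
    fun u v => by simp only [mul_comm (weight τ C n u)]⟩

/-- The percolation probability `π_c(λ) = λ n ^ (-η_s)` (here `lam` is `λ`). -/
noncomputable def piC (τ lam : ℝ) (n : ℕ) : ℝ := lam * (n : ℝ) ^ (-etaS τ)

/-- The unordered pairs of distinct elements of the vertex set `{1, …, n}`. -/
def vertexPairs (n : ℕ) : Finset (Sym2 ℕ) :=
  (Finset.Icc 1 n).sym2.filter (fun e => ¬ e.IsDiag)

/-- A configuration records, for each pair of vertices, whether it is an edge of `NR_n(w)` (first
component) and whether percolation keeps it (second component). -/
abbrev Config (n : ℕ) : Type := vertexPairs n → Bool × Bool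

/-- The Bernoulli law on `Bool` with success probability `p`. The value `p` is truncated to
`[0, 1]`, which matters only for `π_c(λ)` and for the finitely many `n` with `π_c(λ) > 1`. -/
noncomputable def bern (p : ℝ) : Measure Bool :=
  bernoulliMeasure true false (Set.projIcc 0 1 zero_le_one p)

/-- The law of the configuration: all coordinates are independent, the pair `e` is an edge of
`NR_n(w)` with probability `p_e` and is kept with probability `π_c(λ)`. -/
noncomputable def configLaw (τ C lam : ℝ) (n : ℕ) : Measure (Config n) :=
  Measure.pi fun e => (bern (edgeProb τ C n e)).prod (bern (piC τ lam n))

/-- The percolated graph `NR_n(w, π_c(λ))`: its edges are the edges of `NR_n(w)` that percolation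
keeps. It is regarded as a graph on `ℕ` in which the numbers outside `{1, …, n}` are isolated. -/
def percolatedGraph {n : ℕ} (ω : Config n) : SimpleGraph ℕ :=
  SimpleGraph.fromEdgeSet
    {e | ∃ he : e ∈ vertexPairs n, (ω ⟨e, he⟩).1 = true ∧ (ω ⟨e, he⟩).2 = true}

/-- `X_{ij}`: the number of paths of length two from `i` to `j` in `NR_n(w, π_c(λ))`. -/
noncomputable def numTwoPaths {n : ℕ} (i j : ℕ) (ω : Config n) : ℕ :=
  Set.ncard {p : (percolatedGraph ω).Walk i j | p.IsPath ∧ p.length = 2}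

/-- The law of `X_{ij}`. -/
noncomputable def twoPathsLaw (τ C lam : ℝ) (n i j : ℕ) : Measure ℕ :=
  (configLaw τ C lam n).map (numTwoPaths i j)

/-- The index set `{(i, j) : 1 ≤ i < j ≤ K}`. -/
def hubPairs (K : ℕ) : Finset (ℕ × ℕ) :=
  (Finset.Icc 1 K ×ˢ Finset.Icc 1 K).filter (fun p => p.1 < p.2)

/-- The joint law of `(X_{ij})` over `1 ≤ i < j ≤ K`. -/
noncomputable def jointTwoPathsLaw (τ C lam : ℝ) (n K : ℕ) : Measure (hubPairs K → ℕ) :=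
  (configLaw τ C lam n).map fun ω p => numTwoPaths p.1.1 p.1.2 ω

/-! ### The limit -/

/-- `θ_i = c_F i ^ (-α) / μ`. -/
noncomputable def theta (τ C : ℝ) (i : ℕ) : ℝ :=
  cF τ C * (i : ℝ) ^ (-alpha τ) / meanWeight τ C

/-- `Θ_i(x) = 1 - exp (-c_F θ_i x ^ (-α))`. -/
noncomputable def bigTheta (τ C : ℝ) (i : ℕ) (x : ℝ) : ℝ :=
  1 - Real.exp (-(cF τ C * theta τ C i * x ^ (-alpha τ)))

/-- `λ_{ij} = λ² ∫₀^∞ Θ_i(x) Θ_j(x) dx`. -/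
noncomputable def lambdaIJ (τ C lam : ℝ) (i j : ℕ) : ℝ :=
  lam ^ 2 * ∫ x in Set.Ioi (0 : ℝ), bigTheta τ C i x * bigTheta τ C j x

/-- The Poisson law with mean `λ_{ij}` (a nonnegative number). -/
noncomputable def limitLaw (τ C lam : ℝ) (i j : ℕ) : Measure ℕ :=
  poissonMeasure (lambdaIJ τ C lam i j).toNNReal

/-! ### Total variation distance -/

/-- The total variation distance `sup_A |P A - Q A|` of two probability measures. -/
noncomputable def tvDist {S : Type*} [MeasurableSpace S] (P Q : Measure S) : ℝ :=
  ⨆ A : {A : Set S // MeasurableSet A}, |P.real A - Q.real A|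

/-! ### The distribution function and the weights in closed form -/

theorem cF_pos {τ C : ℝ} (hC : 0 < C) : 0 < cF τ C := Real.rpow_pos_of_pos hC _

theorem one_sub_cdf_weightLaw {τ C x : ℝ} (hτ : 1 < τ) (hC : 0 < C) (hx : cF τ C ≤ x) :
    1 - cdf (weightLaw τ C) x = C * x ^ (-(τ - 1)) := by
  have hc := cF_pos (τ := τ) hC
  have hr : 0 < τ - 1 := by linarith
  have hx0 : 0 < x := hc.trans_le hx
  have := isProbabilityMeasure_paretoMeasure hc hr
  have hpow : cF τ C ^ (τ - 1) = C := by
    rw [cF, alpha, ← Real.rpow_mul hC.le, one_div_mul_cancel hr.ne', Real.rpow_one]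
  have h1 : 1 - cdf (weightLaw τ C) x = (weightLaw τ C).real (Set.Ioi x) := by
    rw [weightLaw, cdf_eq_real, ← Set.compl_Iic, probReal_compl_eq_one_sub measurableSet_Iic]
  have h2 : ∀ y ∈ Set.Ioi x, paretoPDF (cF τ C) (τ - 1) y
      = ENNReal.ofReal ((τ - 1) * C * y ^ (-τ)) := fun y hy => by
    rw [paretoPDF_of_le (hx.trans (le_of_lt hy)), hpow]
    norm_num
  rw [h1, weightLaw, paretoMeasure, measureReal_def, withDensity_apply _ measurableSet_Ioi,
    setLIntegral_congr_fun measurableSet_Ioi h2, ← integral_eq_lintegral_of_nonneg_ae]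
  · rw [integral_const_mul, integral_Ioi_rpow_of_lt (by linarith) hx0,
      show -τ + 1 = -(τ - 1) by ring]
    field_simp
  · refine (ae_restrict_iff' measurableSet_Ioi).mpr (ae_of_all _ fun y hy => ?_)
    have : 0 < y := hx0.trans hy
    simp only [Pi.zero_apply]
    positivity
  · fun_prop

theorem weight_eq {τ C : ℝ} (hτ : 1 < τ) (hC : 0 < C) {n i : ℕ} (hi : 1 ≤ i) (hin : i ≤ n) :
    weight τ C n i = cF τ C * ((n : ℝ) / i) ^ alpha τ := by
  have hc := cF_pos (τ := τ) hC
  have hr : 0 < τ - 1 := by linarith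
  have hi0 : (0 : ℝ) < i := by exact_mod_cast hi
  have hn0 : (0 : ℝ) < n := by exact_mod_cast hi.trans hin
  have hα : alpha τ * (-(τ - 1)) = -1 := by rw [alpha]; field_simp
  have hα0 : 0 < alpha τ := by rw [alpha]; positivity
  have hw : cF τ C ≤ cF τ C * ((n : ℝ) / i) ^ alpha τ := by
    refine le_mul_of_one_le_right hc.le (Real.one_le_rpow ?_ hα0.le)
    rw [one_le_div hi0]
    exact_mod_cast hin
  have hval : C * (cF τ C * ((n : ℝ) / i) ^ alpha τ) ^ (-(τ - 1)) = i / n := by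
    rw [cF, ← Real.mul_rpow hC.le (by positivity), ← Real.rpow_mul (by positivity), hα,
      Real.rpow_neg_one]
    field_simp
  refine IsGreatest.csSup_eq ⟨?_, fun x hx => ?_⟩
  · rw [Set.mem_ofPred_eq, one_sub_cdf_weightLaw hτ hC hw, hval]
  · by_contra! hlt
    have hx' : (i : ℝ) / n ≤ 1 - cdf (weightLaw τ C) x := hx
    rw [one_sub_cdf_weightLaw hτ hC (hw.trans hlt.le), ← hval] at hx'
    have := Real.rpow_lt_rpow_of_neg (hc.trans_le hw) hlt (neg_lt_zero.mpr hr)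
    nlinarith

end ScaleFreeNR

/-!
Write `π` for the percolation probability. An edge among the fixed vertices `1, …, K` survives with
probability at most `π → 0`, so up to an event of vanishing probability `X_{ij}` is a sum over the
middle vertices `v ∈ (K, n]`, and the vectors `Y_v` of contributions to the family
`(X_{ij})_{i < j ≤ K}` depend on disjoint sets of edges, hence are independent
(`numTwoPaths_eq_sum_twoPathsThrough`, `indepFun_sum_twoPathsThrough`).

The vector `Y_v` is nearly concentrated on `0` and the unit vectors: two of its coordinates can only
be nonzero together if `v` has three neighbours among `1, …, K`, which costs one more factor `π`.
Le Cam's argument then compares the law of `Y_v` with a product of Poisson laws whose means are the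
probabilities `a_{v,ij} = π² p_{iv} p_{jv}`, with an error of second order, and adds the errors up
over `v`, because total variation is subadditive over convolutions (`tvDist_conv_finset_le`) and
Poisson laws are closed under them. The product form of the limit is what yields the asymptotic
independence. The result is the explicit bound `tvDist_jointTwoPathsLaw_poissonPi_le`, which tends
to `0` as soon as `∑ v, a_{v,ij} → λ_{ij}`.

For this last convergence (`tendsto_sum_twoPathProb`), substitute `x = v n ^ (-(3 - τ))`. Since
`ℓ_n / n → μ`, the edge probability `p_{iv}` is `Θ_i x` up to a factor in the exponent that tends
to `1`, while `π² = λ² n ^ (-(3 - τ))` is `λ²` times the mesh. So the sum is a Riemann sum of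
`λ² ∫ Θ_i Θ_j` over `(0, ∞)`; the integrand is antitone and, because `2 α > 1`, dominated by an
integrable function (`tendsto_riemannSum`).
-/

namespace ScaleFreeNR

/-! ### Total variation distance -/

section TotalVariation

variable {S T : Type*} [MeasurableSpace S] [MeasurableSpace T]

theorem abs_measureReal_sub_le_one (P Q : Measure S) [IsProbabilityMeasure P]
    [IsProbabilityMeasure Q] (A : Set S) : |P.real A - Q.real A| ≤ 1 := by
  have h1 := measureReal_le_one (μ := P) (s := A)
  have h2 := measureReal_le_one (μ := Q) (s := A)
  have h3 := measureReal_nonneg (μ := P) (s := A)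
  have h4 := measureReal_nonneg (μ := Q) (s := A)
  rw [abs_le]
  constructor <;> linarith

theorem abs_sub_le_tvDist (P Q : Measure S) [IsProbabilityMeasure P] [IsProbabilityMeasure Q]
    {A : Set S} (hA : MeasurableSet A) : |P.real A - Q.real A| ≤ tvDist P Q := by
  refine le_ciSup (f := fun A : {A : Set S // MeasurableSet A} => |P.real A - Q.real A|)
    ⟨1, ?_⟩ ⟨A, hA⟩
  rintro _ ⟨B, rfl⟩
  exact abs_measureReal_sub_le_one P Q B

theorem tvDist_le {P Q : Measure S} {c : ℝ}
    (h : ∀ A, MeasurableSet A → |P.real A - Q.real A| ≤ c) : tvDist P Q ≤ c := by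
  have : Nonempty {A : Set S // MeasurableSet A} := ⟨⟨∅, MeasurableSet.empty⟩⟩
  exact ciSup_le fun A => h A A.2

theorem tvDist_nonneg (P Q : Measure S) : 0 ≤ tvDist P Q :=
  Real.iSup_nonneg fun _ => abs_nonneg _

theorem tvDist_comm (P Q : Measure S) : tvDist P Q = tvDist Q P := by
  simp only [tvDist, abs_sub_comm]

theorem tvDist_self (P : Measure S) : tvDist P P = 0 :=
  le_antisymm (tvDist_le fun A _ => by simp) (tvDist_nonneg P P)

theorem tvDist_triangle (P Q R : Measure S) [IsProbabilityMeasure P] [IsProbabilityMeasure Q]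
    [IsProbabilityMeasure R] : tvDist P R ≤ tvDist P Q + tvDist Q R :=
  tvDist_le fun A hA => (abs_sub_le _ (Q.real A) _).trans
    (add_le_add (abs_sub_le_tvDist P Q hA) (abs_sub_le_tvDist Q R hA))

theorem tvDist_map_le (P Q : Measure S) [IsProbabilityMeasure P] [IsProbabilityMeasure Q]
    {f : S → T} (hf : Measurable f) : tvDist (P.map f) (Q.map f) ≤ tvDist P Q := by
  refine tvDist_le fun A hA => ?_
  rw [map_measureReal_apply hf hA, map_measureReal_apply hf hA]
  exact abs_sub_le_tvDist P Q (hf hA)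

/-- The coupling inequality, with an event `B` that contains `{X ≠ Y}`. -/
theorem tvDist_map_map_le {P : Measure S} [IsProbabilityMeasure P] {X Y : S → T}
    (hX : Measurable X) (hY : Measurable Y) {B : Set S} (hB : ∀ ω, ω ∉ B → X ω = Y ω) :
    tvDist (P.map X) (P.map Y) ≤ P.real B := by
  have key : ∀ U V : S → T, (∀ ω, ω ∉ B → U ω = V ω) → ∀ A : Set T,
      P.real (U ⁻¹' A) ≤ P.real (V ⁻¹' A) + P.real B := fun U V hUV A =>
    (measureReal_mono fun ω hω => by
      by_cases h : ω ∈ B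
      · exact Or.inr h
      · exact Or.inl (by simpa [← hUV ω h] using hω)).trans (measureReal_union_le _ _)
  refine tvDist_le fun A hA => ?_
  rw [map_measureReal_apply hX hA, map_measureReal_apply hY hA, abs_le]
  have h1 := key X Y hB A
  have h2 := key Y X (fun ω h => (hB ω h).symm) A
  constructor <;> linarith

/-- Two laws that share masses `m k` at distinct points `x k` are within `1 - ∑ k, m k` of each
other. -/
theorem tvDist_le_one_sub_sum [MeasurableSingletonClass S] {P Q : Measure S}
    [IsProbabilityMeasure P] [IsProbabilityMeasure Q] {κ : Type*} [Fintype κ] {x : κ → S}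
    (hx : Function.Injective x) (m : κ → ℝ)
    (hP : ∀ k, m k ≤ P.real {x k}) (hQ : ∀ k, m k ≤ Q.real {x k}) :
    tvDist P Q ≤ 1 - ∑ k, m k := by
  classical
  have key : ∀ (R : Measure S) [IsProbabilityMeasure R], (∀ k, m k ≤ R.real {x k}) →
      ∀ (A : Set S) (G : Finset κ), (∀ k ∈ G, x k ∈ A) → ∑ k ∈ G, m k ≤ R.real A :=
    fun R _ hR A G hGA => by
    calc ∑ k ∈ G, m k ≤ ∑ k ∈ G, R.real {x k} := Finset.sum_le_sum fun k _ => hR k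
      _ = R.real ↑(G.image x) := by
          rw [← sum_measureReal_singleton, Finset.sum_image fun _ _ _ _ h => hx h]
      _ ≤ R.real A := measureReal_mono (by simpa [Set.subset_def] using hGA)
  refine tvDist_le fun A hA => ?_
  have hsplit := Finset.sum_filter_add_sum_filter_not Finset.univ (x · ∈ A) m
  have hPc := probReal_compl_eq_one_sub (μ := P) hA
  have hQc := probReal_compl_eq_one_sub (μ := Q) hA
  have h1 := key P hP A {k | x k ∈ A} fun k hk => (Finset.mem_filter.mp hk).2
  have h2 := key P hP Aᶜ {k | ¬ x k ∈ A} fun k hk => (Finset.mem_filter.mp hk).2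
  have h3 := key Q hQ A {k | x k ∈ A} fun k hk => (Finset.mem_filter.mp hk).2
  have h4 := key Q hQ Aᶜ {k | ¬ x k ∈ A} fun k hk => (Finset.mem_filter.mp hk).2
  rw [abs_le]
  constructor <;> linarith

end TotalVariation

/-! ### Sums of independent variables -/

section Convolution

variable {M : Type*} [AddCommMonoid M] [MeasurableSpace M] [MeasurableAdd₂ M]

theorem conv_real_apply (P Q : Measure M) [IsProbabilityMeasure P] [IsProbabilityMeasure Q]
    {A : Set M} (hA : MeasurableSet A) :
    (P ∗ Q).real A = ∫ y, P.real ((fun x => x + y) ⁻¹' A) ∂Q := by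
  have hm : MeasurableSet ((fun x : M × M => x.1 + x.2) ⁻¹' A) := measurable_add hA
  rw [measureReal_def, Measure.conv, Measure.map_apply measurable_add hA,
    Measure.prod_apply_symm hm]
  simp only [measureReal_def]
  rw [integral_toReal]
  · rfl
  · exact (measurable_measure_prodMk_right hm).aemeasurable
  · exact ae_of_all _ fun y => measure_lt_top _ _

theorem tvDist_conv_right_le (P₁ P₂ Q : Measure M) [IsProbabilityMeasure P₁]
    [IsProbabilityMeasure P₂] [IsProbabilityMeasure Q] :
    tvDist (P₁ ∗ Q) (P₂ ∗ Q) ≤ tvDist P₁ P₂ := by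
  refine tvDist_le fun A hA => ?_
  have hint : ∀ (P : Measure M) [IsProbabilityMeasure P],
      Integrable (fun y => P.real ((fun x => x + y) ⁻¹' A)) Q := fun P _ => by
    refine Integrable.of_bound (C := 1) ?_ (ae_of_all _ fun y => ?_)
    · exact (measurable_measure_prodMk_right
        (measurable_add hA)).ennreal_toReal.aestronglyMeasurable
    · rw [Real.norm_eq_abs, abs_of_nonneg measureReal_nonneg]
      exact measureReal_le_one
  rw [conv_real_apply P₁ Q hA, conv_real_apply P₂ Q hA, ← integral_sub (hint P₁) (hint P₂)]
  refine (abs_integral_le_integral_abs).trans ?_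
  calc ∫ y, |P₁.real ((fun x => x + y) ⁻¹' A) - P₂.real ((fun x => x + y) ⁻¹' A)| ∂Q
      ≤ ∫ _, tvDist P₁ P₂ ∂Q :=
        integral_mono ((hint P₁).sub (hint P₂)).abs (integrable_const _)
          fun y => abs_sub_le_tvDist P₁ P₂ (measurable_add_const y hA)
    _ = tvDist P₁ P₂ := by simp

theorem tvDist_conv_le (P₁ P₂ Q₁ Q₂ : Measure M) [IsProbabilityMeasure P₁]
    [IsProbabilityMeasure P₂] [IsProbabilityMeasure Q₁] [IsProbabilityMeasure Q₂] :
    tvDist (P₁ ∗ Q₁) (P₂ ∗ Q₂) ≤ tvDist P₁ P₂ + tvDist Q₁ Q₂ := by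
  refine (tvDist_triangle _ (P₂ ∗ Q₁) _).trans (add_le_add (tvDist_conv_right_le _ _ _) ?_)
  rw [Measure.conv_comm P₂ Q₁, Measure.conv_comm P₂ Q₂]
  exact tvDist_conv_right_le _ _ _

/-- Total variation is subadditive over convolutions: `ν₁ s` and `ν₂ s` stand for the convolutions
of the laws `P i` and `Q i` with `i ∈ s`. -/
theorem tvDist_conv_finset_le {ι : Type*} [DecidableEq ι] (P Q : ι → Measure M)
    [∀ i, IsProbabilityMeasure (P i)] [∀ i, IsProbabilityMeasure (Q i)]
    (ν₁ ν₂ : Finset ι → Measure M) [∀ s, IsProbabilityMeasure (ν₁ s)]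
    [∀ s, IsProbabilityMeasure (ν₂ s)] (t : Finset ι) (h0 : ν₁ ∅ = ν₂ ∅)
    (h₁ : ∀ s ⊆ t, ∀ i ∈ t, i ∉ s → ν₁ (insert i s) = ν₁ s ∗ P i)
    (h₂ : ∀ s ⊆ t, ∀ i ∈ t, i ∉ s → ν₂ (insert i s) = ν₂ s ∗ Q i) :
    tvDist (ν₁ t) (ν₂ t) ≤ ∑ i ∈ t, tvDist (P i) (Q i) := by
  refine Finset.induction_on'
    (motive := fun s => tvDist (ν₁ s) (ν₂ s) ≤ ∑ i ∈ s, tvDist (P i) (Q i)) t ?_ fun i s hi hs his ih => ?_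
  · simp [h0, tvDist_self]
  · rw [h₁ s hs i hi his, h₂ s hs i hi his, Finset.sum_insert his, add_comm]
    exact (tvDist_conv_le _ _ _ _).trans (by gcongr)

/-- Total variation is subadditive over products: on a product space the identity is the sum of
the independent variables `Pi.single i (ω i)`. -/
theorem tvDist_pi_le {ι : Type*} [Fintype ι] (P Q : ι → Measure M)
    [∀ i, IsProbabilityMeasure (P i)] [∀ i, IsProbabilityMeasure (Q i)] :
    tvDist (Measure.pi P) (Measure.pi Q) ≤ ∑ i, tvDist (P i) (Q i) := by
  classical
  have hmeas : ∀ i, Measurable (fun x : M => (Pi.single i x : ι → M)) := fun i => by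
    refine measurable_pi_lambda _ fun j => ?_
    by_cases h : j = i
    · subst h; simp only [Pi.single_eq_same]; exact measurable_id
    · simp [h]
  let Z : ι → (ι → M) → (ι → M) := fun i ω => Pi.single i (ω i)
  have hZ : ∀ i, Measurable (Z i) := fun i => (hmeas i).comp (measurable_pi_apply i)
  have hsum : ∀ s : Finset ι, Measurable (∑ i ∈ s, Z i) := fun s => by
    rw [show (∑ i ∈ s, Z i) = fun ω => ∑ i ∈ s, Z i ω from funext fun ω => Finset.sum_apply ω s Z]
    exact Finset.measurable_sum s fun i _ => hZ i
  have hind : ∀ (R : ι → Measure M) [∀ i, IsProbabilityMeasure (R i)],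
      ∀ s i, i ∉ s → (Measure.pi R).map (∑ j ∈ insert i s, Z j)
        = (Measure.pi R).map (∑ j ∈ s, Z j) ∗ ((R i).map fun x : M => (Pi.single i x : ι → M)) :=
      fun R _ s i hi => by
    have hI : iIndepFun Z (Measure.pi R) :=
      iIndepFun_pi (μ := R) (X := fun i x => (Pi.single i x : ι → M))
        fun i => (hmeas i).aemeasurable
    have h1 : ((R i).map fun x : M => (Pi.single i x : ι → M)) = (Measure.pi R).map (Z i) := by
      rw [← (measurePreserving_eval R i).map_eq, Measure.map_map (hmeas i) (measurable_pi_apply i)]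
      rfl
    rw [h1, ← (hI.indepFun_finsetSum_of_notMem hZ hi).map_add_eq_map_conv_map (hsum s) (hZ i),
      Finset.sum_insert hi, add_comm]
  have hid : ∀ R : ι → Measure M, (Measure.pi R).map (∑ i, Z i) = Measure.pi R := fun R => by
    have : (∑ i, Z i) = id := by
      ext ω j
      simp [Z, Finset.sum_apply, Pi.single_apply]
    rw [this, Measure.map_id]
  have hP : ∀ s, IsProbabilityMeasure ((Measure.pi P).map (∑ i ∈ s, Z i)) := fun s =>
    Measure.isProbabilityMeasure_map (hsum s).aemeasurable
  have hQ : ∀ s, IsProbabilityMeasure ((Measure.pi Q).map (∑ i ∈ s, Z i)) := fun s =>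
    Measure.isProbabilityMeasure_map (hsum s).aemeasurable
  have hP1 : ∀ i, IsProbabilityMeasure ((P i).map fun x : M => (Pi.single i x : ι → M)) := fun i =>
    Measure.isProbabilityMeasure_map (μ := P i) (f := fun x : M => (Pi.single i x : ι → M))
      (hmeas i).aemeasurable
  have hQ1 : ∀ i, IsProbabilityMeasure ((Q i).map fun x : M => (Pi.single i x : ι → M)) := fun i =>
    Measure.isProbabilityMeasure_map (μ := Q i) (f := fun x : M => (Pi.single i x : ι → M))
      (hmeas i).aemeasurable
  have := tvDist_conv_finset_le (fun i => (P i).map fun x : M => (Pi.single i x : ι → M))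
    (fun i => (Q i).map fun x : M => (Pi.single i x : ι → M))
    (fun s => (Measure.pi P).map (∑ i ∈ s, Z i)) (fun s => (Measure.pi Q).map (∑ i ∈ s, Z i))
    Finset.univ (by
      simp only [Finset.sum_empty]
      rw [show (0 : (ι → M) → ι → M) = fun _ => 0 from rfl, Measure.map_const, Measure.map_const]
      simp) (fun s _ i _ hi => hind P s i hi) (fun s _ i _ hi => hind Q s i hi)
  rw [hid, hid] at this
  exact this.trans (Finset.sum_le_sum fun i _ => tvDist_map_le _ _ (hmeas i))

theorem pi_conv_pi {ι : Type*} [Fintype ι] (P Q : ι → Measure M)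
    [∀ i, IsProbabilityMeasure (P i)] [∀ i, IsProbabilityMeasure (Q i)] :
    Measure.pi P ∗ Measure.pi Q = Measure.pi fun i => P i ∗ Q i := by
  have h : ∀ i, IsProbabilityMeasure (((P i).prod (Q i)).map fun x : M × M => x.1 + x.2) :=
    fun i => Measure.isProbabilityMeasure_map measurable_add.aemeasurable
  have hadd : Measurable fun x : (ι → M) × (ι → M) => x.1 + x.2 := by
    refine measurable_pi_lambda _ fun i => ?_
    exact ((measurable_pi_apply i).comp measurable_fst).add
      ((measurable_pi_apply i).comp measurable_snd)
  rw [Measure.conv, ← (measurePreserving_arrowProdEquivProdArrow M M ι P Q).map_eq,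
    Measure.map_map hadd (MeasurableEquiv.measurable _)]
  exact Measure.pi_map_pi (μ := fun i => (P i).prod (Q i))
    (f := fun _ (x : M × M) => x.1 + x.2) fun i => measurable_add.aemeasurable

end Convolution

/-! ### Products of Poisson laws -/

section Poisson

open scoped NNReal

variable {ι : Type*} [Fintype ι]

/-- The law of a family of independent Poisson variables with means `a i`. -/
noncomputable def poissonPi (a : ι → ℝ≥0) : Measure (ι → ℕ) :=
  Measure.pi fun i => poissonMeasure (a i)

instance (a : ι → ℝ≥0) : IsProbabilityMeasure (poissonPi a) := by
  unfold poissonPi; infer_instance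

theorem poissonPi_conv (a b : ι → ℝ≥0) : poissonPi a ∗ poissonPi b = poissonPi (a + b) := by
  rw [poissonPi, poissonPi, pi_conv_pi, poissonPi]
  simp only [poissonMeasure_conv_poissonMeasure, Pi.add_apply]

theorem poissonPi_real_singleton (a : ι → ℝ≥0) (x : ι → ℕ) :
    (poissonPi a).real {x} = ∏ i, (poissonMeasure (a i)).real {x i} := by
  rw [measureReal_def, poissonPi, Measure.pi_singleton, ENNReal.toReal_prod]
  rfl

theorem poissonPi_real_zero (a : ι → ℝ≥0) :
    (poissonPi a).real {0} = Real.exp (-∑ i, (a i : ℝ)) := by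
  rw [poissonPi_real_singleton, ← Finset.sum_neg_distrib, Real.exp_sum]
  simp [poissonMeasure_real_singleton]

theorem poissonPi_real_single [DecidableEq ι] (a : ι → ℝ≥0) (i : ι) :
    (poissonPi a).real {Pi.single i 1} = a i * Real.exp (-∑ i, (a i : ℝ)) := by
  rw [poissonPi_real_singleton, ← Finset.sum_neg_distrib, Real.exp_sum,
    ← Finset.mul_prod_erase _ _ (Finset.mem_univ i),
    ← Finset.mul_prod_erase (a := i) _ (fun j => Real.exp (-(a j : ℝ))) (Finset.mem_univ i),
    Finset.prod_congr rfl (g := fun j => Real.exp (-(a j : ℝ)))]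
  · simp [poissonMeasure_real_singleton]
    ring
  · intro j hj
    simp [poissonMeasure_real_singleton, Finset.ne_of_mem_erase hj]

theorem poissonPi_zero : poissonPi (0 : ι → ℝ≥0) = Measure.dirac 0 := by
  have h : poissonMeasure 0 = Measure.dirac 0 := by
    refine Measure.ext_of_singleton fun n => ?_
    rw [poissonMeasure_singleton]
    rcases n with _ | n <;> simp
  simp only [poissonPi, Pi.zero_apply, h]
  exact Measure.pi_eq fun s hs => by
    classical
    simp [Measure.dirac_apply' _ (MeasurableSet.univ_pi hs), Measure.dirac_apply' _ (hs _),
      Set.indicator_apply, Finset.prod_ite_zero]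

theorem tvDist_poissonPi_add_le (a d : ι → ℝ≥0) :
    tvDist (poissonPi a) (poissonPi (a + d)) ≤ ∑ i, (d i : ℝ) := by
  have h : tvDist (poissonPi (0 : ι → ℝ≥0)) (poissonPi d) ≤ ∑ i, (d i : ℝ) := by
    have hexp := Real.add_one_le_exp (-∑ i, (d i : ℝ))
    refine (tvDist_le_one_sub_sum (κ := Unit) (x := fun _ => 0)
      (fun _ _ _ => rfl) (fun _ => Real.exp (-∑ i, (d i : ℝ))) ?_ ?_).trans ?_
    · intro _
      rw [poissonPi_real_zero]
      simp only [Pi.zero_apply, NNReal.coe_zero, Finset.sum_const_zero, neg_zero, Real.exp_zero]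
      exact Real.exp_le_one_iff.mpr (neg_nonpos.mpr (Finset.sum_nonneg fun i _ => (d i).2))
    · intro _
      rw [poissonPi_real_zero]
    · simp only [Finset.univ_unique, Finset.sum_singleton]
      linarith
  calc tvDist (poissonPi a) (poissonPi (a + d))
      = tvDist (poissonPi a ∗ poissonPi 0) (poissonPi a ∗ poissonPi d) := by
        rw [poissonPi_conv, poissonPi_conv, add_zero]
    _ ≤ tvDist (poissonPi a) (poissonPi a) + tvDist (poissonPi 0) (poissonPi d) :=
        tvDist_conv_le _ _ _ _
    _ ≤ ∑ i, (d i : ℝ) := by rw [tvDist_self, zero_add]; exact h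

theorem tvDist_poissonPi_le (a b : ι → ℝ≥0) :
    tvDist (poissonPi a) (poissonPi b) ≤ ∑ i, |(a i : ℝ) - b i| := by
  -- Both laws are compared with the one whose means are the minima, of which they are convolutions
  -- with further Poisson laws.
  have key : ∀ u v : ι → ℝ≥0, tvDist (poissonPi (u ⊓ v)) (poissonPi u)
      ≤ ∑ i, ((u i : ℝ) - min (u i : ℝ) (v i)) := fun u v => by
    have hu : u ⊓ v + (u - u ⊓ v) = u := add_tsub_cancel_of_le inf_le_left
    have := tvDist_poissonPi_add_le (u ⊓ v) (u - u ⊓ v)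
    rw [hu] at this
    refine this.trans (le_of_eq (Finset.sum_congr rfl fun i _ => ?_))
    simp only [Pi.sub_apply, Pi.inf_apply, NNReal.coe_sub inf_le_left, NNReal.coe_min]
  have h1 := key a b
  have h2 := key b a
  rw [inf_comm b a] at h2
  rw [tvDist_comm] at h1
  refine (tvDist_triangle _ (poissonPi (a ⊓ b)) _).trans ((add_le_add h1 h2).trans (le_of_eq ?_))
  rw [← Finset.sum_add_distrib]
  refine Finset.sum_congr rfl fun i _ => ?_
  rcases le_total (a i : ℝ) (b i) with h | h
  · rw [min_eq_left h, min_eq_right h, abs_of_nonpos (by linarith)]; ring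
  · rw [min_eq_right h, min_eq_left h, abs_of_nonneg (by linarith)]; ring

/-- The one-step estimate of Le Cam's argument: a law on `ι → ℕ` that is nearly concentrated on
`0` and the unit vectors is close to a product of Poisson laws, with an error of second order. -/
theorem tvDist_poissonPi_le_of_singleton [DecidableEq ι] {P : Measure (ι → ℕ)}
    [IsProbabilityMeasure P] {a : ι → ℝ≥0} {r : ℝ} (hr : 0 ≤ r)
    (h0 : 1 - ∑ i, (a i : ℝ) ≤ P.real {0})
    (h1 : ∀ i, (a i : ℝ) * (1 - r) ≤ P.real {Pi.single i 1}) :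
    tvDist P (poissonPi a) ≤ (∑ i, (a i : ℝ)) * (∑ i, (a i : ℝ) + r) := by
  have hs : 0 ≤ ∑ i, (a i : ℝ) := Finset.sum_nonneg fun i _ => (a i).2
  have hexp := Real.add_one_le_exp (-∑ i, (a i : ℝ))
  refine (tvDist_le_one_sub_sum (κ := Option ι)
    (x := fun k => k.elim 0 fun i => (Pi.single i 1 : ι → ℕ)) ?_
    (fun k => k.elim (1 - ∑ i, (a i : ℝ)) fun i => a i * (1 - r - ∑ i, (a i : ℝ))) ?_ ?_).trans ?_
  · have hne : ∀ i, (Pi.single i 1 : ι → ℕ) ≠ 0 := fun i h => by simpa using congrFun h i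
    rintro (_ | i) (_ | j) h
    · rfl
    · exact absurd h.symm (hne j)
    · exact absurd h (hne i)
    · by_contra hij
      have hij' : i ≠ j := fun h => hij (by rw [h])
      simpa [hij'] using congrFun h i
  · rintro (_ | i)
    · exact h0
    · exact (mul_le_mul_of_nonneg_left (by linarith) (a i).2).trans (h1 i)
  · rintro (_ | i)
    · simp only [Option.elim_none, poissonPi_real_zero]
      linarith
    · simp only [Option.elim_some, poissonPi_real_single]
      exact mul_le_mul_of_nonneg_left (by linarith) (a i).2
  · simp only [Fintype.sum_option, Option.elim_none, Option.elim_some, ← Finset.sum_mul]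
    exact le_of_eq (by ring)

end Poisson

/-! ### Riemann sums -/

section Riemann

theorem tendsto_intervalIntegral_of_dominated {f : ℕ → ℝ → ℝ} {f₀ g : ℝ → ℝ} {a b : ℕ → ℝ}
    (hf : ∀ n, Measurable (f n)) (hg : IntegrableOn g (Set.Ioi 0))
    (hbound : ∀ᶠ n in atTop, ∀ x, 0 < x → |f n x| ≤ g x)
    (hlim : ∀ x, 0 < x → Tendsto (fun n => f n x) atTop (𝓝 (f₀ x)))
    (ha : ∀ᶠ n in atTop, 0 ≤ a n) (ha0 : Tendsto a atTop (𝓝 0)) (hb : Tendsto b atTop atTop) :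
    Tendsto (fun n => ∫ x in a n..b n, f n x) atTop (𝓝 (∫ x in Set.Ioi 0, f₀ x)) := by
  have h1 : Tendsto (fun n => ∫ x in Set.Ioi 0, (Set.Ioc (a n) (b n)).indicator (f n) x) atTop
      (𝓝 (∫ x in Set.Ioi 0, f₀ x)) := by
    refine tendsto_integral_filter_of_dominated_convergence g
      (Eventually.of_forall fun n => ((hf n).indicator measurableSet_Ioc).aestronglyMeasurable)
      ?_ hg ?_
    · filter_upwards [hbound] with n hn
      refine (ae_restrict_iff' measurableSet_Ioi).mpr (ae_of_all _ fun x hx => ?_)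
      refine (norm_indicator_le_norm_self _ _).trans ?_
      exact hn x hx
    · refine (ae_restrict_iff' measurableSet_Ioi).mpr (ae_of_all _ fun x hx => ?_)
      refine (hlim x hx).congr' ?_
      filter_upwards [ha0.eventually_lt_const (show (0 : ℝ) < x from hx),
        hb.eventually_ge_atTop x] with n h1 h2
      rw [Set.indicator_of_mem (show x ∈ Set.Ioc (a n) (b n) from ⟨h1, h2⟩)]
  refine h1.congr' ?_
  filter_upwards [ha, ha0.eventually_lt_const zero_lt_one, hb.eventually_ge_atTop 1]
    with n h0 h1 h2
  rw [intervalIntegral.integral_of_le (h1.le.trans h2), setIntegral_indicator measurableSet_Ioc,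
    Set.inter_eq_right.mpr fun x hx => Set.mem_Ioi.mpr (lt_of_le_of_lt h0 hx.1)]

/-- Riemann sums with vanishing mesh `h n` over the whole half-line converge to the integral, for
antitone integrands that may vary with `n`. The sum starts above `K ≥ 1`, so the integrands are never
evaluated at `0`, where they may be unbounded or take a junk value. -/
theorem tendsto_riemannSum {f : ℕ → ℝ → ℝ} {f₀ g : ℝ → ℝ} {h : ℕ → ℝ} {K : ℕ} (hK : 1 ≤ K)
    (hf : ∀ n, Measurable (f n)) (hanti : ∀ᶠ n in atTop, AntitoneOn (f n) (Set.Ioi 0))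
    (hg : IntegrableOn g (Set.Ioi 0))
    (hbound : ∀ᶠ n in atTop, ∀ x, 0 < x → |f n x| ≤ g x)
    (hlim : ∀ x, 0 < x → Tendsto (fun n => f n x) atTop (𝓝 (f₀ x)))
    (hh : ∀ᶠ n in atTop, 0 < h n) (hh0 : Tendsto h atTop (𝓝 0))
    (hhn : Tendsto (fun n : ℕ => n * h n) atTop atTop) :
    Tendsto (fun n : ℕ => ∑ v ∈ Finset.Ioc K n, h n * f n (v * h n)) atTop
      (𝓝 (∫ x in Set.Ioi 0, f₀ x)) := by
  have hscale : ∀ n, 0 < h n → ∀ a b : ℝ,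
      h n * ∫ y in a..b, f n (y * h n) = ∫ x in a * h n..b * h n, f n x := fun n hn a b => by
    rw [intervalIntegral.integral_comp_mul_right _ hn.ne', smul_eq_mul, mul_inv_cancel_left₀ hn.ne']
  have hantiF : ∀ n, 0 < h n → AntitoneOn (f n) (Set.Ioi 0) → ∀ a b : ℕ, 1 ≤ a →
      AntitoneOn (fun y : ℝ => f n (y * h n)) (Set.Icc (a : ℝ) b) := fun n hn ha a b hab x hx y hy
      hxy => by
    have ha0 : (0 : ℝ) < a := by exact_mod_cast hab
    exact ha (mul_pos (ha0.trans_le hx.1) hn) (mul_pos (ha0.trans_le hy.1) hn)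
      (mul_le_mul_of_nonneg_right hxy hn.le)
  have hlow : Tendsto (fun n : ℕ => ∫ x in (K + 1 : ℕ) * h n..(n + 1 : ℕ) * h n, f n x) atTop
      (𝓝 (∫ x in Set.Ioi 0, f₀ x)) := by
    refine tendsto_intervalIntegral_of_dominated hf hg hbound hlim ?_ ?_ ?_
    · filter_upwards [hh] with n hn
      positivity
    · simpa using hh0.const_mul ((K + 1 : ℕ) : ℝ)
    · refine tendsto_atTop_mono' _ ?_ hhn
      filter_upwards [hh] with n hn
      push_cast
      nlinarith
  have hupp : Tendsto (fun n : ℕ => ∫ x in K * h n..n * h n, f n x) atTop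
      (𝓝 (∫ x in Set.Ioi 0, f₀ x)) := by
    refine tendsto_intervalIntegral_of_dominated hf hg hbound hlim ?_ ?_ hhn
    · filter_upwards [hh] with n hn
      positivity
    · simpa using hh0.const_mul (K : ℝ)
  refine tendsto_of_tendsto_of_tendsto_of_le_of_le' hlow hupp ?_ ?_
  · filter_upwards [hh, hanti, eventually_ge_atTop K] with n hn ha hKn
    rw [← hscale n hn, ← Finset.mul_sum]
    refine mul_le_mul_of_nonneg_left ?_ hn.le
    have := AntitoneOn.integral_le_sum_Ico (a := K + 1) (b := n + 1) (by omega)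
      (hantiF n hn ha (K + 1) (n + 1) (by omega))
    refine this.trans (le_of_eq (Finset.sum_congr ?_ fun _ _ => rfl))
    ext v; simp only [Finset.mem_Ico, Finset.mem_Ioc]; omega
  · filter_upwards [hh, hanti, eventually_ge_atTop K] with n hn ha hKn
    rw [← hscale n hn, ← Finset.mul_sum]
    refine mul_le_mul_of_nonneg_left ?_ hn.le
    have := AntitoneOn.sum_le_integral_Ico (a := K) (b := n) hKn (hantiF n hn ha K n hK)
    refine le_trans (le_of_eq ?_) this
    rw [Finset.sum_Ico_add' (fun v : ℕ => f n (v * h n)) K n 1]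
    refine Finset.sum_congr ?_ fun _ _ => rfl
    ext v; simp only [Finset.mem_Ico, Finset.mem_Ioc]; omega

end Riemann

/-! ### The mean weight and the total weight -/

section Weights

variable {τ C : ℝ}

theorem alpha_pos (hτ : 2 < τ) : 0 < alpha τ := by
  rw [alpha]; exact one_div_pos.mpr (by linarith)

theorem alpha_lt_one (hτ : 2 < τ) : alpha τ < 1 := by
  rw [alpha, div_lt_one (by linarith)]; linarith

theorem one_lt_two_mul_alpha (hτ2 : 2 < τ) (hτ3 : τ < 3) : 1 < 2 * alpha τ := by
  rw [alpha, mul_one_div, one_lt_div (by linarith)]; linarith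

theorem meanWeight_eq (hτ : 2 < τ) (hC : 0 < C) : meanWeight τ C = cF τ C / (1 - alpha τ) := by
  have hc := cF_pos (τ := τ) hC
  have h1 : (1 - alpha τ) = (τ - 2) / (τ - 1) := by
    have : τ - 1 ≠ 0 := by linarith
    rw [alpha]; field_simp; ring
  have h2 : ∀ x, (paretoPDF (cF τ C) (τ - 1) x).toReal = paretoPDFReal (cF τ C) (τ - 1) x :=
    fun x => ENNReal.toReal_ofReal (paretoPDFReal_nonneg hc.le (by linarith) x)
  have hpow : cF τ C ^ (τ - 1) * cF τ C ^ (-τ + 2) = cF τ C := by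
    rw [← Real.rpow_add hc, show τ - 1 + (-τ + 2) = 1 by ring, Real.rpow_one]
  have hmeas : Measurable (paretoPDF (cF τ C) (τ - 1)) :=
    (measurable_paretoPDFReal _ _).ennreal_ofReal
  rw [meanWeight, weightLaw, paretoMeasure,
    integral_withDensity_eq_integral_toReal_smul hmeas
      (ae_of_all _ fun x => ENNReal.ofReal_lt_top)]
  simp only [h2, smul_eq_mul]
  have h3 : ∀ x, paretoPDFReal (cF τ C) (τ - 1) x * x = (Set.Ici (cF τ C)).indicator
      (fun x => (τ - 1) * cF τ C ^ (τ - 1) * x ^ (-τ + 1)) x := fun x => by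
    rw [paretoPDFReal, Set.indicator_apply]
    by_cases hx : cF τ C ≤ x
    · rw [if_pos hx, if_pos (Set.mem_Ici.mpr hx), Real.rpow_add_one (hc.trans_le hx).ne']
      norm_num
      ring
    · rw [if_neg hx, if_neg (by simpa using hx), zero_mul]
  simp only [h3]
  rw [integral_indicator measurableSet_Ici, integral_Ici_eq_integral_Ioi, integral_const_mul,
    integral_Ioi_rpow_of_lt (by linarith) hc, h1, show -τ + 1 + 1 = -τ + 2 by ring]
  have h4 : τ - 2 ≠ 0 := by linarith
  have h5 : -τ + 2 ≠ 0 := by linarith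
  have h6 : τ - 1 ≠ 0 := by linarith
  calc (τ - 1) * cF τ C ^ (τ - 1) * (-cF τ C ^ (-τ + 2) / (-τ + 2))
      = (cF τ C ^ (τ - 1) * cF τ C ^ (-τ + 2)) * ((τ - 1) / (τ - 2)) := by
        rw [show -τ + 2 = -(τ - 2) by ring] at *
        field_simp
    _ = _ := by rw [hpow]; field_simp

theorem meanWeight_pos (hτ : 2 < τ) (hC : 0 < C) : 0 < meanWeight τ C := by
  rw [meanWeight_eq hτ hC]
  exact div_pos (cF_pos hC) (by linarith [alpha_lt_one hτ])

theorem tendsto_sum_rpow_neg {a : ℝ} (ha0 : 0 < a) (ha1 : a < 1) :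
    Tendsto (fun n : ℕ => (n : ℝ) ^ (a - 1) * ∑ i ∈ Finset.Icc 1 n, (i : ℝ) ^ (-a)) atTop
      (𝓝 (1 / (1 - a))) := by
  have hanti : ∀ n : ℕ, AntitoneOn (fun x : ℝ => x ^ (-a)) (Set.Icc ((1 : ℕ) : ℝ) n) :=
    fun n x hx y _ hxy => Real.rpow_le_rpow_of_nonpos
      (lt_of_lt_of_le (by norm_num) hx.1) hxy (by linarith)
  have hint : ∀ n : ℕ, 1 ≤ n → ∫ x in ((1 : ℕ) : ℝ)..n, x ^ (-a)
      = ((n : ℝ) ^ (1 - a) - 1) / (1 - a) := fun n hn => by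
    rw [integral_rpow (Or.inl (by linarith)), show -a + 1 = 1 - a by ring]
    simp
  have hcancel : ∀ n : ℕ, 1 ≤ n → (n : ℝ) ^ (a - 1) * (n : ℝ) ^ (1 - a) = 1 := fun n hn => by
    rw [← Real.rpow_add (by exact_mod_cast hn)]
    norm_num
  have hzero : Tendsto (fun n : ℕ => (n : ℝ) ^ (a - 1)) atTop (𝓝 0) := by
    have := (tendsto_rpow_neg_atTop (show 0 < 1 - a by linarith)).comp
      (tendsto_natCast_atTop_atTop (R := ℝ))
    simpa [Function.comp_def] using this
  have hlow : Tendsto (fun n : ℕ => (1 - (n : ℝ) ^ (a - 1)) / (1 - a)) atTop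
      (𝓝 (1 / (1 - a))) := by
    simpa using (hzero.const_sub 1).div_const (1 - a)
  have hupp : Tendsto (fun n : ℕ => (n : ℝ) ^ (a - 1) + (1 - (n : ℝ) ^ (a - 1)) / (1 - a)) atTop
      (𝓝 (1 / (1 - a))) := by
    simpa using hzero.add hlow
  refine tendsto_of_tendsto_of_tendsto_of_le_of_le' hlow hupp ?_ ?_
  · filter_upwards [eventually_ge_atTop 1] with n hn
    have h1 := (hanti n).integral_le_sum_Ico hn
    rw [hint n hn] at h1
    have h2 : ∑ i ∈ Finset.Ico 1 n, (i : ℝ) ^ (-a) ≤ ∑ i ∈ Finset.Icc 1 n, (i : ℝ) ^ (-a) :=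
      Finset.sum_le_sum_of_subset_of_nonneg Finset.Ico_subset_Icc_self fun i _ _ => by positivity
    have h3 := mul_le_mul_of_nonneg_left (h1.trans h2)
      (show 0 ≤ (n : ℝ) ^ (a - 1) by positivity)
    rwa [mul_div_assoc', mul_sub, hcancel n hn, mul_one] at h3
  · filter_upwards [eventually_ge_atTop 1] with n hn
    have h1 := (hanti n).sum_le_integral_Ico hn
    rw [hint n hn] at h1
    have h2 : ∑ i ∈ Finset.Icc 1 n, (i : ℝ) ^ (-a)
        = 1 + ∑ i ∈ Finset.Ico 1 n, ((i + 1 : ℕ) : ℝ) ^ (-a) := by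
      rw [Finset.sum_Ico_add' (fun v : ℕ => (v : ℝ) ^ (-a)) 1 n 1, ← Finset.Ico_succ_right_eq_Icc,
        Finset.sum_eq_sum_Ico_succ_bot (by simp; omega)]
      simp
    rw [h2]
    have h3 := mul_le_mul_of_nonneg_left h1 (show 0 ≤ (n : ℝ) ^ (a - 1) by positivity)
    rw [mul_div_assoc', mul_sub, hcancel n hn, mul_one] at h3
    rw [mul_add, mul_one]
    linarith

theorem tendsto_totalWeight_div (hτ : 2 < τ) (hC : 0 < C) :
    Tendsto (fun n : ℕ => totalWeight τ C n / n) atTop (𝓝 (meanWeight τ C)) := by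
  rw [meanWeight_eq hτ hC, div_eq_mul_one_div]
  refine ((tendsto_sum_rpow_neg (alpha_pos hτ) (alpha_lt_one hτ)).const_mul (cF τ C)).congr' ?_
  filter_upwards [eventually_ge_atTop 1] with n hn
  have hn0 : (0 : ℝ) < n := by exact_mod_cast hn
  rw [totalWeight, Finset.sum_div, Finset.mul_sum, Finset.mul_sum]
  refine Finset.sum_congr rfl fun i hi => ?_
  obtain ⟨hi1, hin⟩ := Finset.mem_Icc.mp hi
  rw [weight_eq (by linarith) hC hi1 hin, Real.div_rpow hn0.le (Nat.cast_nonneg i),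
    Real.rpow_neg (Nat.cast_nonneg i), Real.rpow_sub_one hn0.ne']
  field_simp

end Weights

/-! ### Convergence of the expected number of two-paths -/

section Intensity

variable {τ C : ℝ}

/-- The function `x ↦ 1 - exp (-A x ^ (-a))`, of which both `Θ_i` and the rescaled edge
probabilities are instances. -/
noncomputable def expProfile (a A x : ℝ) : ℝ := 1 - Real.exp (-(A * x ^ (-a)))

theorem expProfile_nonneg {a A x : ℝ} (hA : 0 ≤ A) (hx : 0 ≤ x) : 0 ≤ expProfile a A x := by
  rw [expProfile, sub_nonneg, Real.exp_le_one_iff, neg_nonpos]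
  positivity

theorem expProfile_le_one (a A x : ℝ) : expProfile a A x ≤ 1 :=
  sub_le_self _ (Real.exp_pos _).le

theorem expProfile_le (a A x : ℝ) : expProfile a A x ≤ A * x ^ (-a) := by
  have := Real.add_one_le_exp (-(A * x ^ (-a)))
  rw [expProfile]; linarith

theorem antitoneOn_expProfile {a A : ℝ} (ha : 0 ≤ a) (hA : 0 ≤ A) :
    AntitoneOn (expProfile a A) (Set.Ioi 0) := fun x hx y _ hxy => by
  have := mul_le_mul_of_nonneg_left
    (Real.rpow_le_rpow_of_nonpos (show 0 < x from hx) hxy (neg_nonpos.mpr ha)) hA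
  simp only [expProfile]
  gcongr

theorem measurable_expProfile (a A : ℝ) : Measurable (expProfile a A) := by
  unfold expProfile; fun_prop

theorem integrableOn_min_rpow {b D : ℝ} (hb : 1 < b) :
    IntegrableOn (fun x : ℝ => if x ≤ 1 then 1 else D * x ^ (-b)) (Set.Ioi 0) := by
  rw [← Set.Ioc_union_Ioi_eq_Ioi zero_le_one]
  refine IntegrableOn.union ?_ ?_
  · refine IntegrableOn.congr_fun (f := fun _ => (1 : ℝ)) ?_ (fun x hx => (if_pos hx.2).symm)
      measurableSet_Ioc
    simp
  · refine IntegrableOn.congr_fun (f := fun x => D * x ^ (-b)) ?_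
      (fun x hx => (if_neg (not_le.mpr hx)).symm) measurableSet_Ioi
    exact (integrableOn_Ioi_rpow_of_lt (by linarith) zero_lt_one).const_mul D

theorem tendsto_riemannSum_expProfile {a A B : ℝ} {As Bs h : ℕ → ℝ} {K : ℕ} (hK : 1 ≤ K)
    (ha : 1 < 2 * a) (hA : Tendsto As atTop (𝓝 A)) (hB : Tendsto Bs atTop (𝓝 B))
    (hA0 : 0 < A) (hB0 : 0 < B)
    (hh : ∀ᶠ n in atTop, 0 < h n) (hh0 : Tendsto h atTop (𝓝 0))
    (hhn : Tendsto (fun n : ℕ => n * h n) atTop atTop) :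
    Tendsto (fun n : ℕ => ∑ v ∈ Finset.Ioc K n,
        h n * (expProfile a (As n) (v * h n) * expProfile a (Bs n) (v * h n))) atTop
      (𝓝 (∫ x in Set.Ioi 0, expProfile a A x * expProfile a B x)) := by
  have hpos : ∀ᶠ n in atTop, 0 < As n ∧ 0 < Bs n :=
    (hA.eventually_const_lt hA0).and (hB.eventually_const_lt hB0)
  refine tendsto_riemannSum (f := fun n x => expProfile a (As n) x * expProfile a (Bs n) x)
    (g := fun x => if x ≤ 1 then 1 else (A * B + 1) * x ^ (-(2 * a))) hK
    (fun n => (measurable_expProfile _ _).mul (measurable_expProfile _ _)) ?_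
    (integrableOn_min_rpow ha) ?_ ?_ hh hh0 hhn
  · filter_upwards [hpos] with n ⟨hAn, hBn⟩ x hx y hy hxy
    exact mul_le_mul (antitoneOn_expProfile (by linarith) hAn.le hx hy hxy)
      (antitoneOn_expProfile (by linarith) hBn.le hx hy hxy)
      (expProfile_nonneg hBn.le (le_of_lt hy)) (expProfile_nonneg hAn.le (le_of_lt hx))
  · filter_upwards [hpos, (hA.mul hB).eventually_lt_const (lt_add_one (A * B))]
      with n ⟨hAn, hBn⟩ hAB x hx
    have h1 := expProfile_nonneg (a := a) hAn.le hx.le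
    have h2 := expProfile_nonneg (a := a) hBn.le hx.le
    rw [abs_of_nonneg (mul_nonneg h1 h2)]
    split_ifs
    · exact mul_le_one₀ (expProfile_le_one _ _ _) h2 (expProfile_le_one _ _ _)
    · calc expProfile a (As n) x * expProfile a (Bs n) x
          ≤ (As n * x ^ (-a)) * (Bs n * x ^ (-a)) :=
            mul_le_mul (expProfile_le _ _ _) (expProfile_le _ _ _) h2 (by positivity)
        _ = (As n * Bs n) * x ^ (-(2 * a)) := by
            rw [show -(2 * a) = -a + -a by ring, Real.rpow_add hx]; ring
        _ ≤ _ := by gcongr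
  · intro x _
    have key : ∀ {Ds : ℕ → ℝ} {D : ℝ}, Tendsto Ds atTop (𝓝 D) →
        Tendsto (fun n => expProfile a (Ds n) x) atTop (𝓝 (expProfile a D x)) := fun hD =>
      ((Real.continuous_exp.tendsto _).comp (hD.mul_const _).neg).const_sub 1
    exact (key hA).mul (key hB)

theorem bigTheta_eq (i : ℕ) (x : ℝ) :
    bigTheta τ C i x = expProfile (alpha τ) (cF τ C * theta τ C i) x := rfl

theorem theta_pos (hτ : 2 < τ) (hC : 0 < C) {i : ℕ} (hi : 1 ≤ i) : 0 < theta τ C i := by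
  have := cF_pos (τ := τ) hC
  have := meanWeight_pos hτ hC
  have : (0 : ℝ) < i := by exact_mod_cast hi
  rw [theta]; positivity

theorem totalWeight_pos (hτ : 2 < τ) (hC : 0 < C) {n : ℕ} (hn : 1 ≤ n) :
    0 < totalWeight τ C n := by
  refine Finset.sum_pos (fun i hi => ?_) ⟨1, by simpa using hn⟩
  obtain ⟨h1, h2⟩ := Finset.mem_Icc.mp hi
  have : (0 : ℝ) < i := by exact_mod_cast h1
  have : (0 : ℝ) < n := by exact_mod_cast hn
  have := cF_pos (τ := τ) hC
  rw [weight_eq (by linarith) hC h1 h2]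
  positivity

theorem edgeProb_mk (n u v : ℕ) : edgeProb τ C n s(u, v) =
    1 - Real.exp (-(weight τ C n u * weight τ C n v / totalWeight τ C n)) := rfl

theorem edgeProb_mem_Icc (hτ : 2 < τ) (hC : 0 < C) {n u v : ℕ} (hu : 1 ≤ u) (hun : u ≤ n)
    (hv : 1 ≤ v) (hvn : v ≤ n) : edgeProb τ C n s(u, v) ∈ Set.Icc (0 : ℝ) 1 := by
  have hw : ∀ u, 1 ≤ u → u ≤ n → 0 ≤ weight τ C n u := fun u h1 h2 => by
    have := cF_pos (τ := τ) hC
    rw [weight_eq (by linarith) hC h1 h2]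
    positivity
  have h1 := hw u hu hun
  have h2 := hw v hv hvn
  have h3 := totalWeight_pos hτ hC (hu.trans hun)
  rw [edgeProb_mk]
  refine ⟨?_, sub_le_self _ (Real.exp_pos _).le⟩
  rw [sub_nonneg, Real.exp_le_one_iff, neg_nonpos]
  positivity

/-- In the scale `x = v n ^ (-(3 - τ))`, the edge probability `p_{iv}` is `Θ_i` up to the factor
`μ n / ℓ_n → 1` in the exponent. -/
theorem edgeProb_eq_expProfile (hτ : 2 < τ) (hC : 0 < C) {n i v : ℕ} (hi : 1 ≤ i) (hin : i ≤ n)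
    (hv : 1 ≤ v) (hvn : v ≤ n) :
    edgeProb τ C n s(i, v) = expProfile (alpha τ)
      (cF τ C * theta τ C i * (meanWeight τ C / (totalWeight τ C n / n)))
      (v * (n : ℝ) ^ (-(3 - τ))) := by
  have hn0 : (0 : ℝ) < n := by exact_mod_cast hi.trans hin
  have hi0 : (0 : ℝ) < i := by exact_mod_cast hi
  have hv0 : (0 : ℝ) < v := by exact_mod_cast hv
  have hμ := meanWeight_pos hτ hC
  have hl := totalWeight_pos hτ hC (hi.trans hin)
  -- The exponents match because `2 α = 1 + (3 - τ) α`.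
  have hexp : (n : ℝ) ^ (alpha τ) * (n : ℝ) ^ (alpha τ)
      = n * (n : ℝ) ^ (-(3 - τ) * -(alpha τ)) := by
    rw [← Real.rpow_add hn0, ← Real.rpow_one_add' hn0.le]
    · congr 1
      have : τ - 1 ≠ 0 := by linarith
      rw [alpha]; field_simp; ring
    · have h : alpha τ * (τ - 1) = 1 := by
        have : τ - 1 ≠ 0 := by linarith
        rw [alpha]; field_simp
      nlinarith [alpha_pos hτ]
  rw [edgeProb_mk, expProfile, weight_eq (by linarith) hC hi hin,
    weight_eq (by linarith) hC hv hvn, theta, Real.mul_rpow hv0.le (by positivity),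
    ← Real.rpow_mul hn0.le, Real.div_rpow hn0.le hi0.le, Real.div_rpow hn0.le hv0.le,
    Real.rpow_neg hi0.le, Real.rpow_neg hv0.le]
  congr 3
  calc cF τ C * ((n : ℝ) ^ alpha τ / (i : ℝ) ^ alpha τ)
        * (cF τ C * ((n : ℝ) ^ alpha τ / (v : ℝ) ^ alpha τ)) / totalWeight τ C n
      = cF τ C * cF τ C * ((n : ℝ) ^ alpha τ * (n : ℝ) ^ alpha τ)
          / ((i : ℝ) ^ alpha τ * (v : ℝ) ^ alpha τ * totalWeight τ C n) := by field_simp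
    _ = _ := by rw [hexp]; field_simp

theorem piC_sq (lam : ℝ) (n : ℕ) :
    piC τ lam n ^ 2 = lam ^ 2 * (n : ℝ) ^ (-(3 - τ)) := by
  rw [piC, mul_pow, ← Real.rpow_mul_natCast (Nat.cast_nonneg n), etaS]
  congr 2
  push_cast; ring

theorem tendsto_piC (hτ : τ < 3) (lam : ℝ) : Tendsto (piC τ lam) atTop (𝓝 0) := by
  have h : 0 < etaS τ := by rw [etaS]; linarith
  have := ((tendsto_rpow_neg_atTop h).comp (tendsto_natCast_atTop_atTop (R := ℝ))).const_mul lam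
  simpa [show piC τ lam = fun n : ℕ => lam * (n : ℝ) ^ (-etaS τ) from rfl, Function.comp_def]
    using this

/-- The mean number of two-paths from `i` to `j` with middle vertex outside `{1, …, K}` converges
to `λ_{ij}`. -/
theorem tendsto_sum_twoPathProb (hτ2 : 2 < τ) (hτ3 : τ < 3) (hC : 0 < C) (lam : ℝ) {K i j : ℕ}
    (hK : 1 ≤ K) (hi : 1 ≤ i) (hj : 1 ≤ j) :
    Tendsto (fun n : ℕ => ∑ v ∈ Finset.Ioc K n,
        piC τ lam n ^ 2 * (edgeProb τ C n s(i, v) * edgeProb τ C n s(j, v))) atTop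
      (𝓝 (lambdaIJ τ C lam i j)) := by
  have hc := cF_pos (τ := τ) hC
  have hμ := meanWeight_pos hτ2 hC
  have hκ : ∀ k : ℕ, Tendsto (fun n : ℕ =>
      cF τ C * theta τ C k * (meanWeight τ C / (totalWeight τ C n / n))) atTop
      (𝓝 (cF τ C * theta τ C k)) := fun k => by
    have := ((tendsto_const_nhds (x := meanWeight τ C)).div
      (tendsto_totalWeight_div hτ2 hC) hμ.ne').const_mul (cF τ C * theta τ C k)
    rwa [div_self hμ.ne', mul_one] at this
  have hmain := tendsto_riemannSum_expProfile (h := fun n : ℕ => (n : ℝ) ^ (-(3 - τ))) hK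
    (one_lt_two_mul_alpha hτ2 hτ3) (hκ i) (hκ j) (mul_pos hc (theta_pos hτ2 hC hi))
    (mul_pos hc (theta_pos hτ2 hC hj)) ?_ ?_ ?_
  · refine (hmain.const_mul (lam ^ 2)).congr' ?_
    filter_upwards [eventually_ge_atTop i, eventually_ge_atTop j] with n hin hjn
    rw [Finset.mul_sum]
    refine Finset.sum_congr rfl fun v hv => ?_
    obtain ⟨hv1, hv2⟩ := Finset.mem_Ioc.mp hv
    rw [edgeProb_eq_expProfile hτ2 hC hi hin (by omega) hv2,
      edgeProb_eq_expProfile hτ2 hC hj hjn (by omega) hv2, piC_sq]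
    ring
  · filter_upwards [eventually_ge_atTop 1] with n hn
    have : (0 : ℝ) < n := by exact_mod_cast hn
    positivity
  · exact (tendsto_rpow_neg_atTop (show 0 < 3 - τ by linarith)).comp
      (tendsto_natCast_atTop_atTop (R := ℝ))
  · refine ((tendsto_rpow_atTop (show 0 < τ - 2 by linarith)).comp
      (tendsto_natCast_atTop_atTop (R := ℝ))).congr' ?_
    filter_upwards [eventually_ge_atTop 1] with n hn
    have : (0 : ℝ) < n := by exact_mod_cast hn
    simp only [Function.comp_apply]
    rw [show τ - 2 = 1 + -(3 - τ) by ring, Real.rpow_add this, Real.rpow_one]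

theorem lambdaIJ_nonneg (hτ : 2 < τ) (hC : 0 < C) (lam : ℝ) {i j : ℕ} (hi : 1 ≤ i) (hj : 1 ≤ j) :
    0 ≤ lambdaIJ τ C lam i j := by
  have hc := cF_pos (τ := τ) hC
  refine mul_nonneg (sq_nonneg _) (setIntegral_nonneg measurableSet_Ioi fun x hx => ?_)
  rw [bigTheta_eq, bigTheta_eq]
  exact mul_nonneg (expProfile_nonneg (mul_pos hc (theta_pos hτ hC hi)).le (le_of_lt hx))
    (expProfile_nonneg (mul_pos hc (theta_pos hτ hC hj)).le (le_of_lt hx))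

theorem lambdaIJ_comm (lam : ℝ) (i j : ℕ) : lambdaIJ τ C lam i j = lambdaIJ τ C lam j i := by
  simp only [lambdaIJ, mul_comm (bigTheta τ C i _)]

end Intensity

/-! ### Edges and two-paths of the percolated graph -/

section Graph

variable {τ C lam : ℝ} {n K : ℕ}

/-- In the configuration `ω`, the pair `e` is an edge of the percolated graph. -/
def Kept (ω : Config n) (e : Sym2 ℕ) : Prop :=
  ∃ he : e ∈ vertexPairs n, (ω ⟨e, he⟩).1 = true ∧ (ω ⟨e, he⟩).2 = true

theorem mk_mem_vertexPairs {u v : ℕ} :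
    s(u, v) ∈ vertexPairs n ↔ (1 ≤ u ∧ u ≤ n) ∧ (1 ≤ v ∧ v ≤ n) ∧ u ≠ v := by
  simp [vertexPairs, and_assoc]

theorem percolatedGraph_adj {ω : Config n} {u v : ℕ} :
    (percolatedGraph ω).Adj u v ↔ Kept ω s(u, v) := by
  rw [percolatedGraph, SimpleGraph.fromEdgeSet_adj]
  exact ⟨fun h => h.1, fun h => ⟨h, (mk_mem_vertexPairs.mp h.1).2.2⟩⟩

open Classical in
theorem numTwoPaths_eq_sum {i j : ℕ} (hij : i ≠ j) (ω : Config n) :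
    numTwoPaths i j ω
      = ∑ v ∈ Finset.Icc 1 n, if Kept ω s(i, v) ∧ Kept ω s(j, v) then 1 else 0 := by
  have h1 : {p : (percolatedGraph ω).Walk i j | p.IsPath ∧ p.length = 2}
      = {p : (percolatedGraph ω).Walk i j | p.length = 2} := by
    ext p
    refine ⟨fun h => h.2, fun h => ⟨?_, h⟩⟩
    match p, h with
    | .cons h₁ (.cons h₂ .nil), _ =>
      simp [SimpleGraph.Walk.cons_isPath_iff, h₁.ne, h₂.ne, hij]
  have h2 : (percolatedGraph ω).commonNeighbors i j
      = ↑({v ∈ Finset.Icc 1 n | Kept ω s(i, v) ∧ Kept ω s(j, v)}) := by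
    ext v
    simp only [SimpleGraph.mem_commonNeighbors, percolatedGraph_adj, Finset.coe_filter,
      Set.mem_ofPred_eq, Finset.mem_Icc]
    exact ⟨fun h => ⟨(mk_mem_vertexPairs.mp h.1.1).2.1, h⟩, fun h => h.2⟩
  have h3 : Nat.card {p : (percolatedGraph ω).Walk i j | p.length = 2}
      = Nat.card ((percolatedGraph ω).commonNeighbors i j) :=
    Nat.card_congr ((percolatedGraph ω).walkLengthTwoEquivCommonNeighbors i j)
  rw [numTwoPaths, h1, ← Nat.card_coe_set_eq, h3, h2, Nat.card_coe_set_eq,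
    Set.ncard_coe_finset, Finset.card_filter]

theorem numTwoPaths_comm {i j : ℕ} (hij : i ≠ j) (ω : Config n) :
    numTwoPaths i j ω = numTwoPaths j i ω := by
  classical
  rw [numTwoPaths_eq_sum hij, numTwoPaths_eq_sum hij.symm]
  exact Finset.sum_congr rfl fun v _ => if_congr and_comm rfl rfl

theorem mem_hubPairs {p : ℕ × ℕ} : p ∈ hubPairs K ↔ 1 ≤ p.1 ∧ p.1 < p.2 ∧ p.2 ≤ K := by
  simp only [hubPairs, Finset.mem_filter, Finset.mem_product, Finset.mem_Icc]
  omega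

open Classical in
/-- The contribution of the middle vertex `v` to the family `(X_{ij})`. -/
noncomputable def twoPathsThrough (K : ℕ) (v : ℕ) (ω : Config n) : hubPairs K → ℕ :=
  fun p => if Kept ω s(p.1.1, v) ∧ Kept ω s(p.1.2, v) then 1 else 0

theorem twoPathsThrough_of_and {v : ℕ} {ω : Config n} {p : hubPairs K}
    (h : Kept ω s(p.1.1, v) ∧ Kept ω s(p.1.2, v)) : twoPathsThrough K v ω p = 1 := if_pos h

theorem twoPathsThrough_of_not_and {v : ℕ} {ω : Config n} {p : hubPairs K}
    (h : ¬ (Kept ω s(p.1.1, v) ∧ Kept ω s(p.1.2, v))) : twoPathsThrough K v ω p = 0 := if_neg h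

/-- If no two of the vertices `1, …, K` are adjacent, then every two-path between two of them has
its middle vertex outside `{1, …, K}`. -/
theorem numTwoPaths_eq_sum_twoPathsThrough (ω : Config n)
    (hω : ∀ p : hubPairs K, ¬ Kept ω s(p.1.1, p.1.2)) :
    (fun p : hubPairs K => numTwoPaths p.1.1 p.1.2 ω)
      = (∑ v ∈ Finset.Ioc K n, twoPathsThrough K v) ω := by
  ext p
  have hp := mem_hubPairs.mp p.2
  rw [numTwoPaths_eq_sum hp.2.1.ne, Finset.sum_apply, Finset.sum_apply]
  refine (Finset.sum_subset (fun v hv => ?_) fun v hv hvK => ?_).symm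
  · simp only [Finset.mem_Icc, Finset.mem_Ioc] at hv ⊢; omega
  · refine if_neg fun h => ?_
    simp only [Finset.mem_Icc, Finset.mem_Ioc] at hv hvK
    have hne := (mk_mem_vertexPairs.mp h.1.1).2.2
    rcases lt_or_gt_of_ne hne with hlt | hlt
    · exact hω ⟨(p.1.1, v), mem_hubPairs.mpr ⟨hp.1, hlt, by omega⟩⟩ h.1
    · exact hω ⟨(v, p.1.1), mem_hubPairs.mpr ⟨hv.1, hlt, by omega⟩⟩ (Sym2.eq_swap ▸ h.1)

end Graph

/-! ### Edge probabilities and independence -/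

section Law

variable {τ C lam : ℝ} {n K : ℕ}

instance (p : ℝ) : IsProbabilityMeasure (bern p) := by
  unfold bern; infer_instance

instance : IsProbabilityMeasure (configLaw τ C lam n) := by
  unfold configLaw; infer_instance

instance (i j : ℕ) : IsProbabilityMeasure (twoPathsLaw τ C lam n i j) :=
  Measure.isProbabilityMeasure_map Measurable.of_discrete.aemeasurable

instance : IsProbabilityMeasure (jointTwoPathsLaw τ C lam n K) :=
  Measure.isProbabilityMeasure_map Measurable.of_discrete.aemeasurable

instance (i j : ℕ) : IsProbabilityMeasure (limitLaw τ C lam i j) := by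
  unfold limitLaw; infer_instance

theorem bern_real_true {p : ℝ} (hp : p ∈ Set.Icc (0 : ℝ) 1) : (bern p).real {true} = p := by
  rw [bern, bernoulliMeasure_real_apply_of_mem_of_notMem]
  · simp [Set.projIcc_of_mem zero_le_one hp]
  all_goals simp

/-- Distinct pairs are edges of the percolated graph independently of each other. -/
theorem configLaw_real_forall_kept (hτ : 2 < τ) (hC : 0 < C)
    (hπ : piC τ lam n ∈ Set.Icc (0 : ℝ) 1) {E : Finset (Sym2 ℕ)} (hE : E ⊆ vertexPairs n) :
    (configLaw τ C lam n).real {ω | ∀ e ∈ E, Kept ω e}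
      = ∏ e ∈ E, piC τ lam n * edgeProb τ C n e := by
  classical
  have hset : {ω : Config n | ∀ e ∈ E, Kept ω e} = Set.univ.pi
      fun e : vertexPairs n => if e.1 ∈ E then ({true} ×ˢ {true} : Set (Bool × Bool))
        else Set.univ := by
    ext ω
    simp only [Set.mem_ofPred_eq, Set.mem_univ_pi]
    refine ⟨fun h e => ?_, fun h e he => ⟨hE he, ?_⟩⟩
    · split_ifs with he
      · exact (h e.1 he).2
      · trivial
    · have := h ⟨e, hE he⟩
      rwa [if_pos he] at this
  have hfac : ∀ e : vertexPairs n, ((bern (edgeProb τ C n e)).prod (bern (piC τ lam n))).real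
      (if e.1 ∈ E then ({true} ×ˢ {true} : Set (Bool × Bool)) else Set.univ)
        = if e.1 ∈ E then piC τ lam n * edgeProb τ C n e else 1 := fun e => by
    split_ifs with he
    · obtain ⟨e, hep⟩ := e
      induction e using Sym2.inductionOn with
      | hf u v =>
        obtain ⟨⟨h1, h2⟩, ⟨h3, h4⟩, -⟩ := mk_mem_vertexPairs.mp hep
        rw [measureReal_prod_prod, bern_real_true (edgeProb_mem_Icc hτ hC h1 h2 h3 h4),
          bern_real_true hπ, mul_comm]
    · simp
  rw [hset, measureReal_def, configLaw, Measure.pi_pi, ENNReal.toReal_prod]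
  refine (Finset.prod_congr rfl fun e _ => hfac e).trans ?_
  rw [Finset.prod_coe_sort (vertexPairs n)
    (fun e => if e ∈ E then piC τ lam n * edgeProb τ C n e else 1), Finset.prod_ite_mem,
    Finset.inter_eq_right.mpr hE]

/-- Variables that depend on disjoint sets of pairs are independent. -/
theorem indepFun_configLaw {β : Type*} [MeasurableSpace β] {f g : Config n → β}
    {S T : Finset (vertexPairs n)} (hST : Disjoint S T)
    (hf : DependsOn f S) (hg : DependsOn g T) : IndepFun f g (configLaw τ C lam n) := by
  classical
  have hI : iIndepFun (fun (e : vertexPairs n) (ω : Config n) => ω e) (configLaw τ C lam n) :=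
    iIndepFun_pi (X := fun _ => id) fun _ => aemeasurable_id
  -- A function that depends only on the coordinates in `U` factors through the restriction to `U`:
  -- fill up the other coordinates with a default value.
  have hfac : ∀ {U : Finset (vertexPairs n)} {k : Config n → β}, DependsOn k U →
      k = (fun y : U → Bool × Bool => k fun e => if h : e ∈ U then y ⟨e, h⟩ else default) ∘
        fun ω (e : U) => ω e := fun hk => by
    ext ω
    refine hk fun e he => ?_
    simp [Finset.mem_coe.mp he]
  have h := (hI.indepFun_finset S T hST fun e => measurable_pi_apply e).comp
    (φ := fun y : S → Bool × Bool => f fun e => if h : e ∈ S then y ⟨e, h⟩ else default)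
    (ψ := fun y : T → Bool × Bool => g fun e => if h : e ∈ T then y ⟨e, h⟩ else default)
    Measurable.of_discrete Measurable.of_discrete
  rw [← hfac hf, ← hfac hg] at h
  exact h

open Classical in
/-- The pairs that join `v` to one of the vertices `1, …, K`. -/
noncomputable def hubEdges (n K v : ℕ) : Finset (vertexPairs n) :=
  {e | ∃ k ∈ Finset.Icc 1 K, e.1 = s(k, v)}

theorem mem_hubEdges {v : ℕ} {e : vertexPairs n} :
    e ∈ hubEdges n K v ↔ ∃ k, (1 ≤ k ∧ k ≤ K) ∧ e.1 = s(k, v) := by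
  simp [hubEdges]

theorem dependsOn_twoPathsThrough (v : ℕ) :
    DependsOn (twoPathsThrough (n := n) K v) (hubEdges n K v : Set (vertexPairs n)) := by
  intro ω ω' h
  have hk : ∀ k, 1 ≤ k ∧ k ≤ K → (Kept ω s(k, v) ↔ Kept ω' s(k, v)) := fun k hk => by
    have : ∀ he : s(k, v) ∈ vertexPairs n, ω ⟨_, he⟩ = ω' ⟨_, he⟩ := fun he =>
      h _ (Finset.mem_coe.mpr (mem_hubEdges.mpr ⟨k, hk, rfl⟩))
    refine exists_congr fun he => ?_
    rw [this he]
  ext p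
  have hp := mem_hubPairs.mp p.2
  simp only [twoPathsThrough]
  rw [hk p.1.1 (by omega), hk p.1.2 (by omega)]

theorem disjoint_hubEdges {v w : ℕ} (hw : K < w) (hvw : v ≠ w) :
    Disjoint (hubEdges n K v) (hubEdges n K w) := by
  rw [Finset.disjoint_left]
  intro e he he'
  obtain ⟨k, hk, h⟩ := mem_hubEdges.mp he
  obtain ⟨l, hl, h'⟩ := mem_hubEdges.mp he'
  rw [h, Sym2.eq_iff] at h'
  omega

theorem indepFun_sum_twoPathsThrough {s : Finset ℕ} {w : ℕ} (hw : K < w)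
    (hws : w ∉ s) :
    IndepFun (∑ v ∈ s, twoPathsThrough (n := n) K v) (twoPathsThrough K w)
      (configLaw τ C lam n) := by
  classical
  refine indepFun_configLaw (S := s.biUnion (hubEdges n K)) (T := hubEdges n K w) ?_ ?_
    (dependsOn_twoPathsThrough w)
  · rw [Finset.disjoint_biUnion_left]
    exact fun v hv => disjoint_hubEdges hw fun h => hws (h ▸ hv)
  · intro ω ω' h
    rw [Finset.sum_apply, Finset.sum_apply]
    refine Finset.sum_congr rfl fun v hv => dependsOn_twoPathsThrough v fun e he => h e ?_
    exact Finset.mem_coe.mpr (Finset.mem_biUnion.mpr ⟨v, hv, he⟩)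

end Law

/-! ### Poisson approximation -/

section Approximation

open scoped NNReal

variable {τ C lam : ℝ} {n K : ℕ}

/-- The probability that `v` is the middle vertex of a two-path joining the pair `p`,
whenever `K < v ≤ n` and `π_c(λ) ≤ 1`, see `real_kept_and_kept`. -/
noncomputable def twoPathProb (τ C lam : ℝ) (n K v : ℕ) (p : hubPairs K) : ℝ≥0 :=
  Real.toNNReal
    (piC τ lam n ^ 2 * (edgeProb τ C n s(p.1.1, v) * edgeProb τ C n s(p.1.2, v)))

theorem coe_twoPathProb (hτ : 2 < τ) (hC : 0 < C) (hKn : K ≤ n) {v : ℕ} (hv : 1 ≤ v) (hvn : v ≤ n)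
    (p : hubPairs K) : (twoPathProb τ C lam n K v p : ℝ)
      = piC τ lam n ^ 2 * (edgeProb τ C n s(p.1.1, v) * edgeProb τ C n s(p.1.2, v)) := by
  have hp := mem_hubPairs.mp p.2
  refine Real.coe_toNNReal _ (mul_nonneg (sq_nonneg _) (mul_nonneg ?_ ?_))
  · exact (edgeProb_mem_Icc hτ hC hp.1 (by omega) hv hvn).1
  · exact (edgeProb_mem_Icc hτ hC (by omega) (by omega) hv hvn).1

theorem twoPathProb_le (hτ : 2 < τ) (hC : 0 < C) (hKn : K ≤ n) {v : ℕ} (hv : 1 ≤ v) (hvn : v ≤ n)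
    (p : hubPairs K) : (twoPathProb τ C lam n K v p : ℝ) ≤ piC τ lam n ^ 2 := by
  have hp := mem_hubPairs.mp p.2
  rw [coe_twoPathProb hτ hC hKn hv hvn]
  have h1 := edgeProb_mem_Icc hτ hC hp.1 (show p.1.1 ≤ n by omega) hv hvn
  have h2 := edgeProb_mem_Icc hτ hC (show 1 ≤ p.1.2 by omega) (by omega) hv hvn
  exact mul_le_of_le_one_right (sq_nonneg _) (mul_le_one₀ h1.2 h2.1 h2.2)

theorem real_kept_and_kept (hτ : 2 < τ) (hC : 0 < C) (hπ : piC τ lam n ∈ Set.Icc (0 : ℝ) 1)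
    (hKn : K ≤ n) {v : ℕ} (hv : K < v) (hvn : v ≤ n) (p : hubPairs K) :
    (configLaw τ C lam n).real {ω | Kept ω s(p.1.1, v) ∧ Kept ω s(p.1.2, v)}
      = twoPathProb τ C lam n K v p := by
  classical
  have hp := mem_hubPairs.mp p.2
  have hne : s(p.1.1, v) ≠ s(p.1.2, v) := fun h => by
    rw [Sym2.eq_iff] at h; omega
  have hE : ({s(p.1.1, v), s(p.1.2, v)} : Finset (Sym2 ℕ)) ⊆ vertexPairs n := by
    simp only [Finset.insert_subset_iff, Finset.singleton_subset_iff, mk_mem_vertexPairs]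
    omega
  have h := configLaw_real_forall_kept hτ hC hπ hE
  simp only [Finset.mem_insert, Finset.mem_singleton, forall_eq_or_imp, forall_eq] at h
  rw [h, Finset.prod_pair hne, coe_twoPathProb hτ hC hKn (by omega) hvn]
  ring

theorem real_kept_and_kept_and_kept_le (hτ : 2 < τ) (hC : 0 < C)
    (hπ : piC τ lam n ∈ Set.Icc (0 : ℝ) 1) (hKn : K ≤ n) {v : ℕ} (hv : K < v) (hvn : v ≤ n)
    (p : hubPairs K) {k : ℕ} (hk : 1 ≤ k) (hkK : k ≤ K) (hk1 : k ≠ p.1.1) (hk2 : k ≠ p.1.2) :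
    (configLaw τ C lam n).real
        {ω | Kept ω s(k, v) ∧ Kept ω s(p.1.1, v) ∧ Kept ω s(p.1.2, v)}
      ≤ piC τ lam n * twoPathProb τ C lam n K v p := by
  classical
  have hp := mem_hubPairs.mp p.2
  have hne : s(p.1.1, v) ≠ s(p.1.2, v) := fun h => by
    rw [Sym2.eq_iff] at h; omega
  have hne' : s(k, v) ∉ ({s(p.1.1, v), s(p.1.2, v)} : Finset (Sym2 ℕ)) := by
    simp only [Finset.mem_insert, Finset.mem_singleton, Sym2.eq_iff]; omega
  have hE : ({s(k, v), s(p.1.1, v), s(p.1.2, v)} : Finset (Sym2 ℕ)) ⊆ vertexPairs n := by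
    simp only [Finset.insert_subset_iff, Finset.singleton_subset_iff, mk_mem_vertexPairs]
    omega
  have h := configLaw_real_forall_kept hτ hC hπ hE
  simp only [Finset.mem_insert, Finset.mem_singleton, forall_eq_or_imp, forall_eq] at h
  rw [h, Finset.prod_insert hne', Finset.prod_pair hne]
  have hk := (edgeProb_mem_Icc hτ hC hk (hkK.trans hKn) (show 1 ≤ v by omega) hvn).2
  have hq := coe_twoPathProb (lam := lam) hτ hC hKn (show 1 ≤ v by omega) hvn p
  calc _ = piC τ lam n * twoPathProb τ C lam n K v p * edgeProb τ C n s(k, v) := by rw [hq]; ring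
    _ ≤ _ := mul_le_of_le_one_right (mul_nonneg hπ.1 (NNReal.coe_nonneg _)) hk

/-- Two different pairs can only both be joined through `v` if `v` has three neighbours among
`1, …, K`. This makes the law of the contribution of `v` nearly concentrated on `0` and the unit
vectors. -/
theorem tvDist_map_twoPathsThrough_le (hτ : 2 < τ) (hC : 0 < C)
    (hπ : piC τ lam n ∈ Set.Icc (0 : ℝ) 1) (hKn : K ≤ n) {v : ℕ} (hv : K < v) (hvn : v ≤ n) :
    tvDist ((configLaw τ C lam n).map (twoPathsThrough K v))
        (poissonPi (twoPathProb τ C lam n K v))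
      ≤ (∑ p, (twoPathProb τ C lam n K v p : ℝ))
        * (∑ p, (twoPathProb τ C lam n K v p : ℝ) + K * piC τ lam n) := by
  classical
  set μ := configLaw τ C lam n
  have hm : Measurable (twoPathsThrough (n := n) K v) := Measurable.of_discrete
  have : IsProbabilityMeasure (μ.map (twoPathsThrough K v)) :=
    Measure.isProbabilityMeasure_map hm.aemeasurable
  refine tvDist_poissonPi_le_of_singleton (mul_nonneg (Nat.cast_nonneg K) hπ.1) ?_ fun p => ?_
  · rw [map_measureReal_apply hm (measurableSet_singleton _)]
    have hsub : (twoPathsThrough (n := n) K v ⁻¹' {0})ᶜ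
        ⊆ ⋃ p : hubPairs K, {ω | Kept ω s(p.1.1, v) ∧ Kept ω s(p.1.2, v)} := fun ω hω => by
      by_contra hcon
      simp only [Set.mem_iUnion, not_exists] at hcon
      exact hω (funext fun p => twoPathsThrough_of_not_and (hcon p))
    have h1 := (measureReal_mono (μ := μ) hsub).trans (measureReal_iUnion_fintype_le _)
    rw [probReal_compl_eq_one_sub (hm (measurableSet_singleton _)),
      Finset.sum_congr rfl fun p _ => real_kept_and_kept hτ hC hπ hKn hv hvn p] at h1
    linarith
  · rw [map_measureReal_apply hm (measurableSet_singleton _)]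
    -- If the vertices of `p` are the only neighbours of `v` among `1, …, K`, then `p` is the only pair
    -- joined through `v`.
    let T : Finset ℕ := (Finset.Icc 1 K).filter fun k => k ≠ p.1.1 ∧ k ≠ p.1.2
    have hsub : {ω : Config n | Kept ω s(p.1.1, v) ∧ Kept ω s(p.1.2, v)}
        ⊆ (twoPathsThrough (n := n) K v ⁻¹' {Pi.single p 1})
          ∪ ⋃ k ∈ T, {ω | Kept ω s(k, v) ∧ Kept ω s(p.1.1, v) ∧ Kept ω s(p.1.2, v)} :=
      fun ω hω => by
      by_contra hcon
      simp only [Set.mem_union, not_or, Set.mem_iUnion, not_exists] at hcon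
      have hk : ∀ k, 1 ≤ k → k ≤ K → Kept ω s(k, v) → k = p.1.1 ∨ k = p.1.2 :=
        fun k h1 h2 h3 => by
        by_contra hne
        rw [not_or] at hne
        exact hcon.2 k (Finset.mem_filter.mpr ⟨Finset.mem_Icc.mpr ⟨h1, h2⟩, hne⟩) ⟨h3, hω⟩
      refine hcon.1 (funext fun q => ?_)
      by_cases hqp : q = p
      · rw [hqp, Pi.single_eq_same]
        exact twoPathsThrough_of_and hω
      · rw [Pi.single_eq_of_ne hqp]
        refine twoPathsThrough_of_not_and fun h => hqp ?_
        have hq := mem_hubPairs.mp q.2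
        have hp := mem_hubPairs.mp p.2
        have h1 := hk q.1.1 hq.1 (by omega) h.1
        have h2 := hk q.1.2 (by omega) hq.2.2 h.2
        exact Subtype.ext (Prod.ext (by omega) (by omega))
    have hbad : μ.real (⋃ k ∈ T, {ω | Kept ω s(k, v) ∧ Kept ω s(p.1.1, v) ∧ Kept ω s(p.1.2, v)})
        ≤ K * (piC τ lam n * twoPathProb τ C lam n K v p) := by
      refine (measureReal_biUnion_finset_le _ _).trans ?_
      calc _ ≤ ∑ _k ∈ T, piC τ lam n * (twoPathProb τ C lam n K v p : ℝ) :=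
            Finset.sum_le_sum fun k hk => by
              obtain ⟨hk1, hk2, hk3⟩ := Finset.mem_filter.mp hk
              obtain ⟨hk1, hkK⟩ := Finset.mem_Icc.mp hk1
              exact real_kept_and_kept_and_kept_le hτ hC hπ hKn hv hvn p hk1 hkK hk2 hk3
        _ ≤ _ := by
            rw [Finset.sum_const, nsmul_eq_mul]
            refine mul_le_mul_of_nonneg_right ?_ (mul_nonneg hπ.1 (NNReal.coe_nonneg _))
            exact_mod_cast (Finset.card_filter_le _ _).trans (by simp)
    have h1 := (measureReal_mono (μ := μ) hsub).trans (measureReal_union_le _ _)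
    rw [real_kept_and_kept hτ hC hπ hKn hv hvn p] at h1
    linarith

/-- The multivariate Le Cam bound for the two-paths whose middle vertex lies outside
`{1, …, K}`. -/
theorem tvDist_map_sum_twoPathsThrough_le (hτ : 2 < τ) (hC : 0 < C)
    (hπ : piC τ lam n ∈ Set.Icc (0 : ℝ) 1) (hKn : K ≤ n) :
    tvDist ((configLaw τ C lam n).map (∑ v ∈ Finset.Ioc K n, twoPathsThrough K v))
        (poissonPi (∑ v ∈ Finset.Ioc K n, twoPathProb τ C lam n K v))
      ≤ ∑ v ∈ Finset.Ioc K n, (∑ p, (twoPathProb τ C lam n K v p : ℝ))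
        * (∑ p, (twoPathProb τ C lam n K v p : ℝ) + K * piC τ lam n) := by
  have hprob : ∀ f : Config n → hubPairs K → ℕ,
      IsProbabilityMeasure ((configLaw τ C lam n).map f) := fun f =>
    Measure.isProbabilityMeasure_map Measurable.of_discrete.aemeasurable
  refine (tvDist_conv_finset_le
    (fun v => (configLaw τ C lam n).map (twoPathsThrough K v))
    (fun v => poissonPi (twoPathProb τ C lam n K v))
    (fun s => (configLaw τ C lam n).map (∑ v ∈ s, twoPathsThrough K v))
    (fun s => poissonPi (∑ v ∈ s, twoPathProb τ C lam n K v)) (Finset.Ioc K n) ?_ ?_ ?_).trans ?_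
  · simp only [Finset.sum_empty]
    rw [poissonPi_zero, show (0 : Config n → hubPairs K → ℕ) = fun _ => 0 from rfl,
      Measure.map_const]
    simp
  · intro s _ w hw hws
    rw [Finset.sum_insert hws, add_comm]
    exact (indepFun_sum_twoPathsThrough (Finset.mem_Ioc.mp hw).1 hws).map_add_eq_map_conv_map
      Measurable.of_discrete Measurable.of_discrete
  · intro s _ w _ hws
    rw [Finset.sum_insert hws, add_comm, poissonPi_conv]
  · refine Finset.sum_le_sum fun v hv => ?_
    obtain ⟨hv, hvn⟩ := Finset.mem_Ioc.mp hv
    exact tvDist_map_twoPathsThrough_le hτ hC hπ hKn hv hvn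

theorem real_exists_kept_le (hτ : 2 < τ) (hC : 0 < C) (hπ : piC τ lam n ∈ Set.Icc (0 : ℝ) 1)
    (hKn : K ≤ n) :
    (configLaw τ C lam n).real {ω | ∃ p : hubPairs K, Kept ω s(p.1.1, p.1.2)}
      ≤ (hubPairs K).card * piC τ lam n := by
  rw [show {ω : Config n | ∃ p : hubPairs K, Kept ω s(p.1.1, p.1.2)}
    = ⋃ p : hubPairs K, {ω | Kept ω s(p.1.1, p.1.2)} by ext; simp]
  refine (measureReal_iUnion_fintype_le _).trans ?_
  calc _ ≤ ∑ _p : hubPairs K, piC τ lam n := Finset.sum_le_sum fun p _ => by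
        have hp := mem_hubPairs.mp p.2
        have h := configLaw_real_forall_kept (E := {s(p.1.1, p.1.2)}) hτ hC hπ (by
          simp only [Finset.singleton_subset_iff, mk_mem_vertexPairs]; omega)
        simp only [Finset.mem_singleton, forall_eq, Finset.prod_singleton] at h
        rw [h]
        exact mul_le_of_le_one_right hπ.1
          (edgeProb_mem_Icc hτ hC hp.1 (by omega) (by omega) (by omega)).2
    _ = _ := by simp

theorem tvDist_jointTwoPathsLaw_poissonPi_le (hτ : 2 < τ) (hC : 0 < C)
    (hπ : piC τ lam n ∈ Set.Icc (0 : ℝ) 1) (hKn : K ≤ n) (ℓ : hubPairs K → ℝ≥0) :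
    tvDist (jointTwoPathsLaw τ C lam n K) (poissonPi ℓ)
      ≤ (hubPairs K).card * piC τ lam n
        + (∑ p, ∑ v ∈ Finset.Ioc K n, (twoPathProb τ C lam n K v p : ℝ))
          * ((hubPairs K).card * piC τ lam n ^ 2 + K * piC τ lam n)
        + ∑ p, |∑ v ∈ Finset.Ioc K n, (twoPathProb τ C lam n K v p : ℝ) - ℓ p| := by
  have hprob : IsProbabilityMeasure
      ((configLaw τ C lam n).map (∑ v ∈ Finset.Ioc K n, twoPathsThrough K v)) :=
    Measure.isProbabilityMeasure_map Measurable.of_discrete.aemeasurable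
  have h1 : tvDist (jointTwoPathsLaw τ C lam n K)
      ((configLaw τ C lam n).map (∑ v ∈ Finset.Ioc K n, twoPathsThrough K v))
        ≤ (hubPairs K).card * piC τ lam n :=
    (tvDist_map_map_le (B := {ω | ∃ p : hubPairs K, Kept ω s(p.1.1, p.1.2)})
      Measurable.of_discrete Measurable.of_discrete fun ω hω =>
      numTwoPaths_eq_sum_twoPathsThrough ω fun p hp => hω ⟨p, hp⟩).trans
        (real_exists_kept_le hτ hC hπ hKn)
  have h2 : tvDist ((configLaw τ C lam n).map (∑ v ∈ Finset.Ioc K n, twoPathsThrough K v))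
      (poissonPi (∑ v ∈ Finset.Ioc K n, twoPathProb τ C lam n K v))
        ≤ (∑ p, ∑ v ∈ Finset.Ioc K n, (twoPathProb τ C lam n K v p : ℝ))
          * ((hubPairs K).card * piC τ lam n ^ 2 + K * piC τ lam n) := by
    refine (tvDist_map_sum_twoPathsThrough_le hτ hC hπ hKn).trans ?_
    rw [Finset.sum_comm, Finset.sum_mul]
    refine Finset.sum_le_sum fun v hv => ?_
    obtain ⟨hv, hvn⟩ := Finset.mem_Ioc.mp hv
    refine mul_le_mul_of_nonneg_left ?_ (Finset.sum_nonneg fun p _ => NNReal.coe_nonneg _)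
    gcongr
    calc _ ≤ ∑ _p : hubPairs K, piC τ lam n ^ 2 :=
          Finset.sum_le_sum fun p _ => twoPathProb_le hτ hC hKn (by omega) hvn p
      _ = _ := by simp
  have h3 := tvDist_poissonPi_le (∑ v ∈ Finset.Ioc K n, twoPathProb τ C lam n K v) ℓ
  simp only [Finset.sum_apply, NNReal.coe_sum] at h3
  refine (tvDist_triangle _ (poissonPi (∑ v ∈ Finset.Ioc K n, twoPathProb τ C lam n K v)) _).trans
    (add_le_add ((tvDist_triangle _ _ _).trans (add_le_add h1 h2)) h3)

end Approximation

/-! ### The limit -/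

section Limit

variable {τ C : ℝ}

theorem tendsto_tvDist_jointTwoPathsLaw (hτ2 : 2 < τ) (hτ3 : τ < 3) (hC : 0 < C) {lam : ℝ}
    (hlam : 0 < lam) {K : ℕ} (hK : 1 ≤ K) :
    Tendsto (fun n : ℕ => tvDist (jointTwoPathsLaw τ C lam n K)
      (Measure.pi fun p : hubPairs K => limitLaw τ C lam p.1.1 p.1.2)) atTop (𝓝 0) := by
  have hπ := tendsto_piC hτ3 lam
  have hsum : ∀ p : hubPairs K, Tendsto (fun n : ℕ =>
      ∑ v ∈ Finset.Ioc K n, (twoPathProb τ C lam n K v p : ℝ)) atTop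
      (𝓝 (lambdaIJ τ C lam p.1.1 p.1.2)) := fun p => by
    have hp := mem_hubPairs.mp p.2
    refine (tendsto_sum_twoPathProb hτ2 hτ3 hC lam hK hp.1 (show 1 ≤ p.1.2 by omega)).congr' ?_
    filter_upwards [eventually_ge_atTop K] with n hn
    refine Finset.sum_congr rfl fun v hv => ?_
    obtain ⟨hv, hvn⟩ := Finset.mem_Ioc.mp hv
    rw [coe_twoPathProb hτ2 hC hn (by omega) hvn]
  have hcoe : ∀ p : hubPairs K,
      ((lambdaIJ τ C lam p.1.1 p.1.2).toNNReal : ℝ) = lambdaIJ τ C lam p.1.1 p.1.2 := fun p => by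
    have hp := mem_hubPairs.mp p.2
    exact Real.coe_toNNReal _ (lambdaIJ_nonneg hτ2 hC lam hp.1 (by omega))
  have hbound := ((hπ.const_mul ((hubPairs K).card : ℝ)).add
    ((tendsto_finsetSum Finset.univ fun p _ => hsum p).mul
      (((hπ.pow 2).const_mul ((hubPairs K).card : ℝ)).add (hπ.const_mul (K : ℝ))))).add
    (tendsto_finsetSum Finset.univ fun p _ =>
      ((hsum p).sub_const (lambdaIJ τ C lam p.1.1 p.1.2)).abs)
  simp only [mul_zero, ne_eq, OfNat.ofNat_ne_zero, not_false_eq_true, zero_pow, add_zero, sub_self,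
    abs_zero, Finset.sum_const_zero] at hbound
  refine squeeze_zero' (Eventually.of_forall fun n => tvDist_nonneg _ _) ?_ hbound
  filter_upwards [eventually_ge_atTop K, hπ.eventually_le_const zero_lt_one] with n hn hπ1
  have hπ0 : 0 ≤ piC τ lam n := by rw [piC]; positivity
  have := tvDist_jointTwoPathsLaw_poissonPi_le hτ2 hC ⟨hπ0, hπ1⟩ hn
    fun p : hubPairs K => (lambdaIJ τ C lam p.1.1 p.1.2).toNNReal
  simp only [hcoe] at this
  exact this

theorem twoPathsLaw_comm {lam : ℝ} {n i j : ℕ} (hij : i ≠ j) :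
    twoPathsLaw τ C lam n i j = twoPathsLaw τ C lam n j i := by
  rw [twoPathsLaw, twoPathsLaw, funext (numTwoPaths_comm hij)]

theorem limitLaw_comm (lam : ℝ) (i j : ℕ) : limitLaw τ C lam i j = limitLaw τ C lam j i := by
  rw [limitLaw, limitLaw, lambdaIJ_comm]

theorem tendsto_tvDist_twoPathsLaw (hτ2 : 2 < τ) (hτ3 : τ < 3) (hC : 0 < C) {lam : ℝ}
    (hlam : 0 < lam) {i j : ℕ} (hi : 1 ≤ i) (hj : 1 ≤ j) (hij : i ≠ j) :
    Tendsto (fun n : ℕ => tvDist (twoPathsLaw τ C lam n i j) (limitLaw τ C lam i j))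
      atTop (𝓝 0) := by
  -- With `i < j`, the law of `X_{ij}` is a marginal of the joint law for `K = j`.
  wlog hlt : i < j generalizing i j
  · simp only [twoPathsLaw_comm hij, limitLaw_comm lam i j]
    exact this hj hi hij.symm (by omega)
  let p : hubPairs j := ⟨(i, j), mem_hubPairs.mpr ⟨hi, hlt, le_rfl⟩⟩
  refine squeeze_zero (fun n => tvDist_nonneg _ _) (fun n => ?_)
    (tendsto_tvDist_jointTwoPathsLaw hτ2 hτ3 hC hlam hj)
  have h1 : (jointTwoPathsLaw τ C lam n j).map (Function.eval p) = twoPathsLaw τ C lam n i j := by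
    rw [jointTwoPathsLaw, Measure.map_map (measurable_pi_apply p) Measurable.of_discrete]
    rfl
  have h2 := (measurePreserving_eval
    (fun p : hubPairs j => limitLaw τ C lam p.1.1 p.1.2) p).map_eq
  have := tvDist_map_le (jointTwoPathsLaw τ C lam n j)
    (Measure.pi fun p : hubPairs j => limitLaw τ C lam p.1.1 p.1.2) (measurable_pi_apply p)
  rw [h2] at this
  exact h1 ▸ this

end Limit

end ScaleFreeNR

theorem proposition3p3 (τ C lam : ℝ) (hτ2 : 2 < τ) (hτ3 : τ < 3) (hC : 0 < C) (hlam : 0 < lam) :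
    (∀ i j : ℕ, 1 ≤ i → 1 ≤ j → i ≠ j →
      Tendsto
        (fun n : ℕ =>
          ScaleFreeNR.tvDist (ScaleFreeNR.twoPathsLaw τ C lam n i j)
            (ScaleFreeNR.limitLaw τ C lam i j))
        atTop (𝓝 0)) ∧
    (∀ K : ℕ, 1 ≤ K →
      Tendsto
        (fun n : ℕ =>
          ScaleFreeNR.tvDist (ScaleFreeNR.jointTwoPathsLaw τ C lam n K)
            (Measure.pi fun p : ScaleFreeNR.hubPairs K =>
              ScaleFreeNR.twoPathsLaw τ C lam n p.1.1 p.1.2))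
        atTop (𝓝 0) ∧
      Tendsto
        (fun n : ℕ =>
          ScaleFreeNR.tvDist (ScaleFreeNR.jointTwoPathsLaw τ C lam n K)
            (Measure.pi fun p : ScaleFreeNR.hubPairs K =>
              ScaleFreeNR.limitLaw τ C lam p.1.1 p.1.2))
        atTop (𝓝 0)) := by
  have hsingle : ∀ i j : ℕ, 1 ≤ i → 1 ≤ j → i ≠ j → _ := fun i j hi hj hij =>
    ScaleFreeNR.tendsto_tvDist_twoPathsLaw (C := C) hτ2 hτ3 hC hlam hi hj hij
  have hjoint : ∀ K : ℕ, 1 ≤ K → _ := fun K hK =>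
    ScaleFreeNR.tendsto_tvDist_jointTwoPathsLaw (C := C) hτ2 hτ3 hC hlam hK
  refine ⟨hsingle, fun K hK => ⟨?_, hjoint K hK⟩⟩
  have hprod : Tendsto (fun n : ℕ => ∑ p : ScaleFreeNR.hubPairs K,
      ScaleFreeNR.tvDist (ScaleFreeNR.limitLaw τ C lam p.1.1 p.1.2)
        (ScaleFreeNR.twoPathsLaw τ C lam n p.1.1 p.1.2)) atTop (𝓝 0) := by
    rw [← Finset.sum_const_zero (ι := ScaleFreeNR.hubPairs K) (s := Finset.univ)]
    refine tendsto_finsetSum _ fun p _ => ?_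
    have hp := ScaleFreeNR.mem_hubPairs.mp p.2
    simp only [ScaleFreeNR.tvDist_comm (ScaleFreeNR.limitLaw τ C lam p.1.1 p.1.2)]
    exact hsingle p.1.1 p.1.2 hp.1 (by omega) hp.2.1.ne
  -- The product of the laws of the `X_{ij}` is compared with the joint law through the common limit.
  have hbound := (hjoint K hK).add hprod
  rw [add_zero] at hbound
  refine squeeze_zero (fun n => ScaleFreeNR.tvDist_nonneg _ _) (fun n => ?_) hbound
  exact (ScaleFreeNR.tvDist_triangle _ (Measure.pi fun p : ScaleFreeNR.hubPairs K =>
    ScaleFreeNR.limitLaw τ C lam p.1.1 p.1.2) _).trans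
      (add_le_add_right (ScaleFreeNR.tvDist_pi_le _ _) _)
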